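/- Setting. Let $n_1,n_2,m\ge 1$. Given $M_1,\dots,M_m\in\mathbb C^{n_1\times n_2}$, let $\mathcal A:\mathbb C^{n_1\times n_2}\to\mathbb C^m$, $[\mathcal A(Z)]_\ell=\operatorname{trace}(M_\ell^*Z)$, with adjoint $\mathcal A^*(z)=\sum_\ell z_\ell M_\ell$. It is an i.i.d. Gaussian measurement operator if all entries of all $M_\ell$ are independent with law $\mathcal{CN}(0,1/m)$ (real and imaginary parts independent $\mathcal N(0,\tfrac1{2m})$). It satisfies the rank-2 and $(k_1,k_2)$-sparse RIP with constant $\delta$ if $(1-\delta)\|Z\|_F^2\le\|\mathcal A(Z)\|_2^2\le(1+\delta)\|Z\|_F^2$ for all $Z$ of rank at most $2$ with at most $k_1$ nonzero rows and at most $k_2$ nonzero columns; the rank-2 and row-$k$-sparse RIP is the same with at most $k$ nonzero rows and no restriction on columns. Sparse power factorization (SPF). Let $F(y)$ be the $m\times n_1$ matrix with rows $y^*M_\ell^*$ and $G(x)$ the $m\times n_2$ matrix with rows $x^*M_\ell$, so that $\mathcal A(xy^*)=F(y)x=\overline{G(x)y}$. Given data $b$, sparsity levels $s_1\le n_1$,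 $s_2\le n_2$ and $v_0$, SPF computes for $t=1,2,\dots$: replace $v_{t-1}$ by $v_{t-1}/\|v_{t-1}\|_2$ in this step; let $\tilde u_t$ be the output of HTP$(F(v_{t-1}),b,s_1)$ if $s_1<n_1$, and a minimizer of $\|b-F(v_{t-1})x\|_2$ if $s_1=n_1$; $u_t=\tilde u_t/\|\tilde u_t\|_2$; let $v_t$ be the output of HTP$(G(u_t),\overline b,s_2)$ if $s_2<n_2$, and a minimizer of $\|\overline b-G(u_t)y\|_2$ if $s_2=n_2$; set $X_t=u_tv_t^*$. Here HTP$(\Phi,b,s)$ starts at $x_0=0$ and iterates: $J$ is the support of a best $s$-term approximation of $x_{k-1}+\Phi^*(b-\Phi x_{k-1})$, and $x_k$ minimizes $\|b-\Phi x\|_2$ over $x$ supported in $J$. The optimal initialization takes $v_0$ to be a leading (unit) right singular vector of $\Pi_{J_1}\mathcal A^*(b)\Pi_{J_2}$, where $\Pi_J$ is the coordinate projection onto $J$ and $(J_1,J_2)$ maximizes the spectral norm of this matrix over $|J_1|=s_1$, $|J_2|=s_2$; in the row-sparse case ($s_2=n_2$) it takes a leading right singular vector of $\Pi_{J}\mathcal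 A^*(b)$ with $J$ maximizing the spectral norm over $|J|=s_1$. Ties are broken arbitrarily. Say that SPF *recovers stably at levels $(s_1,s_2)$* with constants $L,H,\kappa$ if for every $X=\lambda uv^*$ with $\lambda>0$, $\|u\|_2=\|v\|_2=1$, $u$ $s_1$-sparse, $v$ $s_2$-sparse, and every $z\in\mathbb C^m$ with $\|z\|_2\le 0.04\,\|\mathcal A(X)\|_2$, the SPF iterates for $b=\mathcal A(X)+z$ from the optimal initialization, with every HTP call for the left (resp. right) factor run for at least $L+Hs_1$ (resp. $L+Hs_2$) iterations, satisfy $$\limsup_{t\to\infty}\frac{\|X_t-X\|_F}{\|X\|_F}\le \kappa\,\frac{\|z\|_2}{\|\mathcal A(X)\|_2}.$$ Theorem. There are absolute constants $L,H,\kappa>0$ such that for every $\delta\in(0,1)$ there are $C,c,C'>0$, depending only on $\delta$, with the following properties. (i) Let $1\le s_1\le n_1$, $1\le s_2\le n_2$ and $\Lambda=\log\big(e\max(n_1,n_2)/s\big)$ with $s=\max(s_1,s_2)$. If $m\ge C(s_1+s_2)\Lambda$ and $\mathcal A$ is an i.i.d. Gaussian measurement operator, then with probability at least $1-2e^{-cm}$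 both of the following hold: $\mathcal A$ satisfies the rank-2 and $(3s_1,3s_2)$-sparse RIP with constant $\delta$, and SPF recovers stably at levels $(s_1,s_2)$ with constants $L,H,\kappa$. Moreover this number of measurements is within a logarithmic factor of the information-theoretic lower bound $s_1+s_2-2$: $\lceil C(s_1+s_2)\Lambda\rceil\le C'\Lambda\max(1,s_1+s_2-2)$. (ii) (Row-sparse case.) Let $1\le s\le n_1$, $n_2\ge1$ and $\Lambda=\log(en_1/s)$. If $m\ge C(s+n_2)\Lambda$ and $\mathcal A$ is an i.i.d. Gaussian measurement operator, then with probability at least $1-2e^{-cm}$ both of the following hold: $\mathcal A$ satisfies the rank-2 and row-$3s$-sparse RIP with constant $\delta$, and SPF recovers stably at levels $(s,n_2)$ with constants $L,H,\kappa$. Moreover $\lceil C(s+n_2)\Lambda\rceil\le C'\Lambda\max(1,s+n_2-2)$. -/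

import Mathlib

open MeasureTheory ProbabilityTheory Filter
open scoped Matrix NNReal ENNReal

noncomputable section

namespace SparsePF

/-! ### Vectors and matrices -/

/-- The Euclidean (`ℓ₂`) norm of a complex vector. -/
def l2norm {n : ℕ} (x : Fin n → ℂ) : ℝ := ‖WithLp.toLp 2 x‖

/-- The number of nonzero entries of a vector. -/
def zeroNorm {n : ℕ} (x : Fin n → ℂ) : ℕ := {i | x i ≠ 0}.ncard

/-- `x / ‖x‖₂`. -/
def normalize {n : ℕ} (x : Fin n → ℂ) : Fin n → ℂ := fun i => x i / (l2norm x : ℂ)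

/-- The Frobenius norm. -/
def frobNorm {n₁ n₂ : ℕ} (Z : Matrix (Fin n₁) (Fin n₂) ℂ) : ℝ :=
  Real.sqrt (∑ j, ∑ k, ‖Z j k‖ ^ 2)

/-- The spectral norm: the operator norm for the Euclidean norms. -/
def specNorm {n₁ n₂ : ℕ} (Z : Matrix (Fin n₁) (Fin n₂) ℂ) : ℝ :=
  ‖LinearMap.toContinuousLinearMap (Matrix.toEuclideanLin Z)‖

/-- The number of nonzero rows of a matrix. -/
def nonzeroRows {n₁ n₂ : ℕ} (Z : Matrix (Fin n₁) (Fin n₂) ℂ) : ℕ := {j | ∃ k, Z j k ≠ 0}.ncard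

/-- The number of nonzero columns of a matrix. -/
def nonzeroCols {n₁ n₂ : ℕ} (Z : Matrix (Fin n₁) (Fin n₂) ℂ) : ℕ := {k | ∃ j, Z j k ≠ 0}.ncard

/-- The rank-one matrix `x y^*`. -/
def outer {n₁ n₂ : ℕ} (x : Fin n₁ → ℂ) (y : Fin n₂ → ℂ) : Matrix (Fin n₁) (Fin n₂) ℂ :=
  Matrix.vecMulVec x (star y)

/-- The coordinate projection `Π_J`. -/
def coordProj {n : ℕ} (J : Finset (Fin n)) : Matrix (Fin n) (Fin n) ℂ :=
  Matrix.diagonal fun i => if i ∈ J then 1 else 0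

/-- `v` is a unit right singular vector of `B` for the largest singular value `‖B‖`. -/
def IsLeadingRightSingularVector {n₁ n₂ : ℕ} (B : Matrix (Fin n₁) (Fin n₂) ℂ)
    (v : Fin n₂ → ℂ) : Prop :=
  l2norm v = 1 ∧ (Bᴴ * B) *ᵥ v = ((specNorm B ^ 2 : ℝ) : ℂ) • v

/-! ### The measurement operator given by matrices `M₁, …, M_m` -/

/-- `[𝒜(Z)]_ℓ = ⟨M_ℓ, Z⟩ = trace (M_ℓ^* Z)`. -/
def sensing {m n₁ n₂ : ℕ} (M : Fin m → Matrix (Fin n₁) (Fin n₂) ℂ)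
    (Z : Matrix (Fin n₁) (Fin n₂) ℂ) : Fin m → ℂ := fun l => ((M l)ᴴ * Z).trace

/-- The adjoint `𝒜^*(z) = ∑ z_ℓ M_ℓ`. -/
def sensingAdj {m n₁ n₂ : ℕ} (M : Fin m → Matrix (Fin n₁) (Fin n₂) ℂ)
    (z : Fin m → ℂ) : Matrix (Fin n₁) (Fin n₂) ℂ := ∑ l, z l • M l

/-- The matrix `F(y)` with rows `y^* M_ℓ^*`, so that `𝒜(x y^*) = F(y) x`. -/
def opF {m n₁ n₂ : ℕ} (M : Fin m → Matrix (Fin n₁) (Fin n₂) ℂ) (y : Fin n₂ → ℂ) :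
    Matrix (Fin m) (Fin n₁) ℂ := Matrix.of fun l => star y ᵥ* (M l)ᴴ

/-- The matrix `G(x)` with rows `x^* M_ℓ`, so that `𝒜(x y^*)` is the conjugate of `G(x) y`. -/
def opG {m n₁ n₂ : ℕ} (M : Fin m → Matrix (Fin n₁) (Fin n₂) ℂ) (x : Fin n₁ → ℂ) :
    Matrix (Fin m) (Fin n₂) ℂ := Matrix.of fun l => star x ᵥ* M l

/-- The rank-`r` and doubly `(k₁, k₂)`-sparse restricted isometry property with isometry
constant `δ`. -/
def DoublySparseRIP {m n₁ n₂ : ℕ} (M : Fin m → Matrix (Fin n₁) (Fin n₂) ℂ)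
    (r k₁ k₂ : ℕ) (δ : ℝ) : Prop :=
  ∀ Z : Matrix (Fin n₁) (Fin n₂) ℂ, Z.rank ≤ r → nonzeroRows Z ≤ k₁ → nonzeroCols Z ≤ k₂ →
    (1 - δ) * frobNorm Z ^ 2 ≤ l2norm (sensing M Z) ^ 2 ∧
      l2norm (sensing M Z) ^ 2 ≤ (1 + δ) * frobNorm Z ^ 2

/-- The rank-`r` and row-`k`-sparse restricted isometry property with isometry constant `δ`. -/
def RowSparseRIP {m n₁ n₂ : ℕ} (M : Fin m → Matrix (Fin n₁) (Fin n₂) ℂ)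
    (r k : ℕ) (δ : ℝ) : Prop :=
  ∀ Z : Matrix (Fin n₁) (Fin n₂) ℂ, Z.rank ≤ r → nonzeroRows Z ≤ k →
    (1 - δ) * frobNorm Z ^ 2 ≤ l2norm (sensing M Z) ^ 2 ∧
      l2norm (sensing M Z) ^ 2 ≤ (1 + δ) * frobNorm Z ^ 2

/-! ### Gaussian measurements -/

/-- The circular complex Gaussian law `𝒞𝒩(0, σ²)`: real and imaginary parts are independent
with law `𝒩(0, σ²/2)`. -/
def complexGaussian (σ2 : ℝ≥0) : Measure ℂ :=
  ((gaussianReal 0 (σ2 / 2)).prod (gaussianReal 0 (σ2 / 2))).map fun p => (⟨p.1, p.2⟩ : ℂ)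

/-- All entries of the `m` random measurement matrices are i.i.d. `𝒞𝒩(0, 1/m)`. -/
structure IsIIDGaussian {Ω : Type*} [MeasurableSpace Ω] (μ : Measure Ω) {m n₁ n₂ : ℕ}
    (M : Ω → Fin m → Matrix (Fin n₁) (Fin n₂) ℂ) : Prop where
  indep : iIndepFun (fun (p : Fin m × Fin n₁ × Fin n₂) ω => M ω p.1 p.2.1 p.2.2) μ
  law : ∀ l j k, HasLaw (fun ω => M ω l j k) (complexGaussian (1 / (m : ℝ≥0))) μ

/-! ### Hard thresholding pursuit and sparse power factorization

Every `argmin`, `argmax` and best `s`-term approximation is a relation, so that all ways of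
breaking ties are allowed. -/

/-- `x` minimizes `‖b - Φ x‖₂` among the vectors supported in `J`. -/
def IsLeastSquaresOn {m n : ℕ} (Φ : Matrix (Fin m) (Fin n) ℂ) (b : Fin m → ℂ)
    (J : Set (Fin n)) (x : Fin n → ℂ) : Prop :=
  (∀ i, i ∉ J → x i = 0) ∧
    ∀ x' : Fin n → ℂ, (∀ i, i ∉ J → x' i = 0) → l2norm (b - Φ *ᵥ x) ≤ l2norm (b - Φ *ᵥ x')

/-- `J` is the support of a best `s`-term approximation `H_s[y]` of `y`. -/
def IsHardThresholdSupport {n : ℕ} (s : ℕ) (y : Fin n → ℂ) (J : Set (Fin n)) : Prop :=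
  ∃ T : Finset (Fin n), T.card = s ∧ (∀ i ∈ T, ∀ j ∉ T, ‖y j‖ ≤ ‖y i‖) ∧
    J = {i | i ∈ T ∧ y i ≠ 0}

/-- One iteration of HTP, with step size one. -/
def IsHTPStep {m n : ℕ} (Φ : Matrix (Fin m) (Fin n) ℂ) (b : Fin m → ℂ) (s : ℕ)
    (x x' : Fin n → ℂ) : Prop :=
  ∃ J : Set (Fin n), IsHardThresholdSupport s (x + Φᴴ *ᵥ (b - Φ *ᵥ x)) J ∧
    IsLeastSquaresOn Φ b J x'

/-- `x` is an iterate of HTP, started at zero, of index at least `N`. -/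
def IsHTPOutput {m n : ℕ} (Φ : Matrix (Fin m) (Fin n) ℂ) (b : Fin m → ℂ) (s N : ℕ)
    (x : Fin n → ℂ) : Prop :=
  ∃ (ξ : ℕ → Fin n → ℂ) (k : ℕ), N ≤ k ∧ ξ 0 = 0 ∧
    (∀ i, IsHTPStep Φ b s (ξ i) (ξ (i + 1))) ∧ x = ξ k

/-- The update of one factor in SPF: HTP with at least `N` iterations if `s < n`, and plain
least squares otherwise. -/
def IsFactorUpdate {m n : ℕ} (Φ : Matrix (Fin m) (Fin n) ℂ) (b : Fin m → ℂ) (s N : ℕ)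
    (x : Fin n → ℂ) : Prop :=
  if s < n then IsHTPOutput Φ b s N x else IsLeastSquaresOn Φ b Set.univ x

/-- `(u_t)`, `(v_t)` are iterates of SPF for the data `b`, started at `v₀`; the HTP calls for the
left and right factors run for at least `N₁` and `N₂` iterations. (`u 0` plays no role.) -/
structure IsSPFRun {m n₁ n₂ : ℕ} (M : Fin m → Matrix (Fin n₁) (Fin n₂) ℂ) (b : Fin m → ℂ)
    (s₁ s₂ N₁ N₂ : ℕ) (v₀ : Fin n₂ → ℂ) (u : ℕ → Fin n₁ → ℂ) (v : ℕ → Fin n₂ → ℂ) : Prop where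
  start : v 0 = v₀
  left : ∀ t, ∃ w, IsFactorUpdate (opF M (normalize (v t))) b s₁ N₁ w ∧ u (t + 1) = normalize w
  right : ∀ t, IsFactorUpdate (opG M (u (t + 1))) (star b) s₂ N₂ (v (t + 1))

/-- The optimal starting vector computed from the proxy matrix `B = 𝒜^*(b)`: a leading right
singular vector of a submatrix `Π_{J₁} B Π_{J₂}` with `|J₁| = s₁`, `|J₂| = s₂` whose spectral norm
is maximal. -/
def IsOptimalStart {n₁ n₂ : ℕ} (s₁ s₂ : ℕ) (B : Matrix (Fin n₁) (Fin n₂) ℂ)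
    (v₀ : Fin n₂ → ℂ) : Prop :=
  ∃ (J₁ : Finset (Fin n₁)) (J₂ : Finset (Fin n₂)), J₁.card = s₁ ∧ J₂.card = s₂ ∧
    (∀ (K₁ : Finset (Fin n₁)) (K₂ : Finset (Fin n₂)), K₁.card = s₁ → K₂.card = s₂ →
      specNorm (coordProj K₁ * B * coordProj K₂) ≤ specNorm (coordProj J₁ * B * coordProj J₂)) ∧
    IsLeadingRightSingularVector (coordProj J₁ * B * coordProj J₂) v₀

/-- The optimal starting vector in the row-sparse case: a leading right singular vector of a row
submatrix `Π_J B` with `|J| = s` whose spectral norm is maximal. -/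
def IsRowOptimalStart {n₁ n₂ : ℕ} (s : ℕ) (B : Matrix (Fin n₁) (Fin n₂) ℂ)
    (v₀ : Fin n₂ → ℂ) : Prop :=
  ∃ J : Finset (Fin n₁), J.card = s ∧
    (∀ K : Finset (Fin n₁), K.card = s → specNorm (coordProj K * B) ≤ specNorm (coordProj J * B)) ∧
    IsLeadingRightSingularVector (coordProj J * B) v₀

/-- Stable recovery by SPF, uniformly in the unknown matrix `X = lam • u v^*` and the noise `z`:
whenever the noise-to-signal ratio is at most `0.04` and the HTP calls run for at least
`L + H s₁` and `L + H s₂` iterations, the iterates `X_t = u_t v_t^*` satisfy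
`limsup_t ‖X_t - X‖_F / ‖X‖_F ≤ κ ‖z‖₂ / ‖𝒜(X)‖₂`. -/
def StablyRecovers {m n₁ n₂ : ℕ} (M : Fin m → Matrix (Fin n₁) (Fin n₂) ℂ) (s₁ s₂ : ℕ)
    (Start : Matrix (Fin n₁) (Fin n₂) ℂ → (Fin n₂ → ℂ) → Prop) (L H κ : ℝ) : Prop :=
  ∀ (lam : ℝ) (u : Fin n₁ → ℂ) (v : Fin n₂ → ℂ) (X : Matrix (Fin n₁) (Fin n₂) ℂ)
    (z b : Fin m → ℂ),
    0 < lam → l2norm u = 1 → l2norm v = 1 → zeroNorm u ≤ s₁ → zeroNorm v ≤ s₂ →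
    X = (lam : ℂ) • outer u v →
    b = sensing M X + z → l2norm z ≤ 0.04 * l2norm (sensing M X) →
    ∀ (N₁ N₂ : ℕ), L + H * s₁ ≤ N₁ → L + H * s₂ ≤ N₂ →
    ∀ (v₀ : Fin n₂ → ℂ) (U : ℕ → Fin n₁ → ℂ) (V : ℕ → Fin n₂ → ℂ),
      Start (sensingAdj M b) v₀ → IsSPFRun M b s₁ s₂ N₁ N₂ v₀ U V →
      ∀ ε > 0, ∀ᶠ t in atTop,
        frobNorm (outer (U t) (V t) - X) / frobNorm X ≤
          κ * (l2norm z / l2norm (sensing M X)) + ε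

/-! ### Numbers of measurements -/

/-- `log (e max(n₁, n₂) / s)` with `s = max(s₁, s₂)`. -/
def doublyLog (n₁ n₂ s₁ s₂ : ℕ) : ℝ :=
  Real.log (Real.exp 1 * (max n₁ n₂ : ℕ) / (max s₁ s₂ : ℕ))

/-- `log (e n₁ / s)`. -/
def rowLog (n₁ s : ℕ) : ℝ := Real.log (Real.exp 1 * n₁ / s)

end SparsePF

end

/-! The whole theorem rests on one deterministic property, `BilinRIP` at levels `(3 s₁, 3 s₂)` with
a small `ε`: inner products of sparse rank-one matrices with common supports survive the measurement
up to a relative error `ε`. It gives the rank-2 RIP (`BilinRIP.isometry`) and stable recovery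
(`BilinRIP.stablyRecovers`), and a Gaussian operator has it with probability at least `1 - 2
exp(-cm)` (`IsIIDGaussian.measure_not_bilinRIP_le`).

Recovery. Fix a unit vector `y` and split `v` into its projection on `y` and an orthogonal rest
`v'`. In the least squares problem for the left factor the signal is a multiple of `u`, while `v'`
only contributes the vector `lam • 𝒜(u v'^*)`. Since `v'` is orthogonal to `y`, the property makes
that vector nearly orthogonal to everything `F(y)` can produce from sparse vectors. A half-step of
SPF therefore sees noise of size about `ε · lam · sin∠(v, y) + ‖z‖`, and multiplies the sine of the
angle to the truth by at most `1/10`, up to a multiple of the noise (`BilinRIP.factorUpdate`). The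
right half-step is the same statement for the adjoint matrices. The optimal start has cosine at
least `1/2`, because the maximal spectral norm is at least what the pair `(u, v)` achieves, which
forces the maximizer to correlate with `v` (`BilinRIP.optimalStart`).

Each factor update needs HTP to reach the noise level after a number of iterations linear in `s`,
whatever the dynamic range of the target. The part of the target missed by the current support
shrinks geometrically until it reaches the noise level. A double count, in which each index of the
support is charged at most 2, shows that this takes at most `2 s` steps (`exists_missed_le`).

Probability. For a fixed matrix, `‖𝒜(Z)‖²` concentrates by a Chernoff bound for squares of
Gaussians. Polarization passes from norms to inner products. Nets in each of the four vector
arguments separately, and a union over supports, extend the bound to all sparse vectors; the entropy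
is absorbed by half of the exponent. -/

namespace SparsePF

/-! ### The Euclidean norm -/

section Norm

variable {n : ℕ}

theorem l2norm_nonneg (x : Fin n → ℂ) : 0 ≤ l2norm x := norm_nonneg _

theorem l2norm_add_le (x y : Fin n → ℂ) : l2norm (x + y) ≤ l2norm x + l2norm y := by
  simpa [l2norm] using norm_add_le (WithLp.toLp 2 x) (WithLp.toLp 2 y)

theorem l2norm_sub_le (x y : Fin n → ℂ) : l2norm (x - y) ≤ l2norm x + l2norm y := by
  simpa [l2norm] using norm_sub_le (WithLp.toLp 2 x) (WithLp.toLp 2 y)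

theorem l2norm_smul (c : ℂ) (x : Fin n → ℂ) : l2norm (c • x) = ‖c‖ * l2norm x := by
  simpa [l2norm] using norm_smul c (WithLp.toLp 2 x)

@[simp] theorem l2norm_zero : l2norm (0 : Fin n → ℂ) = 0 := by simp [l2norm]

theorem l2norm_eq_zero {x : Fin n → ℂ} : l2norm x = 0 ↔ x = 0 := by simp [l2norm]

theorem l2norm_sq (x : Fin n → ℂ) : l2norm x ^ 2 = ∑ i, ‖x i‖ ^ 2 := by
  simp [l2norm, EuclideanSpace.norm_sq_eq]

theorem l2norm_star (x : Fin n → ℂ) : l2norm (star x) = l2norm x := by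
  rw [← sq_eq_sq₀ (l2norm_nonneg _) (l2norm_nonneg _), l2norm_sq, l2norm_sq]
  simp

theorem star_dotProduct_eq_inner (x y : Fin n → ℂ) :
    star x ⬝ᵥ y = inner ℂ (WithLp.toLp 2 x) (WithLp.toLp 2 y) := by
  rw [EuclideanSpace.inner_toLp_toLp, dotProduct_comm]

theorem norm_star_dotProduct_le (x y : Fin n → ℂ) : ‖star x ⬝ᵥ y‖ ≤ l2norm x * l2norm y := by
  rw [star_dotProduct_eq_inner]; exact norm_inner_le_norm _ _

theorem star_dotProduct_self (x : Fin n → ℂ) : star x ⬝ᵥ x = ((l2norm x ^ 2 : ℝ) : ℂ) := by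
  rw [star_dotProduct_eq_inner, inner_self_eq_norm_sq_to_K]; simp [l2norm]

theorem star_star_dotProduct (x y : Fin n → ℂ) : star (star x ⬝ᵥ y) = star y ⬝ᵥ x := by
  rw [Matrix.star_dotProduct, star_star]

theorem norm_star_dotProduct_comm (x y : Fin n → ℂ) : ‖star x ⬝ᵥ y‖ = ‖star y ⬝ᵥ x‖ := by
  rw [← star_star_dotProduct, norm_star]

/-- A residual of minimal norm along a line is orthogonal to the line. -/
theorem star_dotProduct_eq_zero_of_le {r g : Fin n → ℂ}
    (h : ∀ c : ℂ, l2norm r ≤ l2norm (r - c • g)) : star g ⬝ᵥ r = 0 := by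
  by_cases hg : g = 0
  · simp [hg]
  have hg0 : 0 < l2norm g := lt_of_le_of_ne (l2norm_nonneg _) (Ne.symm (mt l2norm_eq_zero.1 hg))
  set p := star g ⬝ᵥ r with hp
  have hp' : star r ⬝ᵥ g = star p := by rw [hp, star_star_dotProduct]
  have key : ∀ c : ℂ, (((l2norm (r - c • g)) ^ 2 : ℝ) : ℂ)
      = ((l2norm r ^ 2 : ℝ) : ℂ) - c * star p - star c * p + star c * c * ((l2norm g ^ 2 : ℝ) : ℂ) := by
    intro c
    rw [← star_dotProduct_self, ← star_dotProduct_self, ← star_dotProduct_self]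
    simp only [star_sub, star_smul, sub_dotProduct, dotProduct_sub, smul_dotProduct, dotProduct_smul,
      smul_eq_mul, hp', ← hp]
    ring
  -- This `c` minimizes the quadratic `key`; there the squared norm drops by `‖p‖² / ‖g‖²`, so
  -- minimality forces `p = 0`.
  have h1 := key (p / ((l2norm g ^ 2 : ℝ) : ℂ))
  have hG : ((l2norm g ^ 2 : ℝ) : ℂ) ≠ 0 := by exact_mod_cast (pow_pos hg0 2).ne'
  have h2 : p * star p = ((‖p‖ ^ 2 : ℝ) : ℂ) := by
    have := Complex.mul_conj p
    rw [Complex.normSq_eq_norm_sq] at this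
    exact this
  have h3 : (((l2norm (r - (p / ((l2norm g ^ 2 : ℝ) : ℂ)) • g)) ^ 2 : ℝ) : ℂ)
      = ((l2norm r ^ 2 - ‖p‖ ^ 2 / l2norm g ^ 2 : ℝ) : ℂ) := by
    rw [h1]
    have hs : star (p / ((l2norm g ^ 2 : ℝ) : ℂ)) = star p / ((l2norm g ^ 2 : ℝ) : ℂ) := by
      simp
    rw [hs, Complex.ofReal_sub, Complex.ofReal_div, ← h2]
    field_simp
    ring
  have h4 := Complex.ofReal_injective h3
  have h5 := pow_le_pow_left₀ (l2norm_nonneg _) (h (p / ((l2norm g ^ 2 : ℝ) : ℂ))) 2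
  rw [h4] at h5
  have h6 : ‖p‖ ^ 2 / l2norm g ^ 2 ≤ 0 := by linarith
  have h7 : ‖p‖ ^ 2 ≤ 0 := by
    rcases div_nonpos_iff.1 h6 with h | h
    · have := pow_pos hg0 2; linarith [h.2]
    · exact h.1
  have : ‖p‖ = 0 := by nlinarith [norm_nonneg p]
  simpa using this

/-- The projection to a line is the best approximation from the line. -/
theorem l2norm_sub_proj_le {g : Fin n → ℂ} (hg : l2norm g = 1) (r : Fin n → ℂ) (c : ℂ) :
    l2norm (r - (star g ⬝ᵥ r) • g) ≤ l2norm (r - c • g) := by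
  have horth : star g ⬝ᵥ (r - (star g ⬝ᵥ r) • g) = 0 := by
    rw [dotProduct_sub, dotProduct_smul, star_dotProduct_self, hg]; simp
  set q := r - (star g ⬝ᵥ r) • g with hq
  have h : r - c • g = q + (star g ⬝ᵥ r - c) • g := by rw [hq, sub_smul]; abel
  have hsq : (((l2norm (r - c • g)) ^ 2 : ℝ) : ℂ)
      = ((l2norm q ^ 2 + ‖star g ⬝ᵥ r - c‖ ^ 2 : ℝ) : ℂ) := by
    have horth' : star q ⬝ᵥ g = 0 := by rw [← star_star_dotProduct, horth, star_zero]
    rw [h, ← star_dotProduct_self]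
    simp only [star_add, star_smul, add_dotProduct, dotProduct_add, smul_dotProduct,
      dotProduct_smul, smul_eq_mul, star_dotProduct_self, horth, horth', hg]
    have := Complex.mul_conj (star g ⬝ᵥ r - c)
    rw [Complex.normSq_eq_norm_sq] at this
    push_cast at this ⊢
    rw [← this, Complex.star_def]
    ring
  have := Complex.ofReal_injective hsq
  refine le_of_sq_le_sq ?_ (l2norm_nonneg _)
  nlinarith [sq_nonneg ‖star g ⬝ᵥ r - c‖]

/-- Pythagoras, in the form `sin² + cos² = 1`; it converts bounds on `sinAngle` into bounds on the
correlation and back. -/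
theorem l2norm_sub_proj_sq {g r : Fin n → ℂ} (hg : l2norm g = 1) (hr : l2norm r = 1) :
    l2norm (r - (star g ⬝ᵥ r) • g) ^ 2 + ‖star g ⬝ᵥ r‖ ^ 2 = 1 := by
  have hp' : star r ⬝ᵥ g = star (star g ⬝ᵥ r) := by rw [star_star_dotProduct]
  set p := star g ⬝ᵥ r with hp
  have h2 : p * star p = ((‖p‖ ^ 2 : ℝ) : ℂ) := by
    have := Complex.mul_conj p
    rw [Complex.normSq_eq_norm_sq] at this
    exact this
  apply Complex.ofReal_injective
  rw [Complex.ofReal_add, ← h2, ← star_dotProduct_self]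
  simp only [star_sub, star_smul, sub_dotProduct, dotProduct_sub, smul_dotProduct, dotProduct_smul,
      smul_eq_mul, hp', ← hp, star_dotProduct_self, hg, hr]
  push_cast
  ring

theorem l2norm_normalize {x : Fin n → ℂ} (hx : x ≠ 0) : l2norm (normalize x) = 1 := by
  have h : normalize x = ((l2norm x : ℂ)⁻¹) • x := by
    ext i; simp [normalize, div_eq_inv_mul]
  rw [h, l2norm_smul, norm_inv, Complex.norm_real, Real.norm_of_nonneg (l2norm_nonneg x)]
  exact inv_mul_cancel₀ (mt l2norm_eq_zero.1 hx)

theorem l2norm_smul_normalize (x : Fin n → ℂ) : (l2norm x : ℂ) • normalize x = x := by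
  by_cases hx : x = 0
  · simp [hx]
  ext i
  have : (l2norm x : ℂ) ≠ 0 := by exact_mod_cast mt l2norm_eq_zero.1 hx
  simp only [normalize, Pi.smul_apply, smul_eq_mul]
  field_simp

theorem normalize_of_l2norm_eq_one {x : Fin n → ℂ} (hx : l2norm x = 1) : normalize x = x := by
  ext i; simp [normalize, hx]

theorem l2norm_indicator_sq (J : Set (Fin n)) (x : Fin n → ℂ) :
    l2norm (J.indicator x) ^ 2 = star (J.indicator x) ⬝ᵥ x := by
  classical
  rw [← Complex.ofReal_pow, ← star_dotProduct_self]
  simp only [dotProduct]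
  refine Finset.sum_congr rfl fun i _ => ?_
  by_cases h : i ∈ J <;> simp [h]

theorem l2norm_indicator_mono {J K : Set (Fin n)} (h : J ⊆ K) (x : Fin n → ℂ) :
    l2norm (J.indicator x) ≤ l2norm (K.indicator x) := by
  classical
  refine le_of_sq_le_sq ?_ (l2norm_nonneg _)
  rw [l2norm_sq, l2norm_sq]
  refine Finset.sum_le_sum fun i _ => ?_
  by_cases hJ : i ∈ J
  · simp [hJ, h hJ]
  · simp [hJ]

end Norm

end SparsePF

namespace SparsePF

/-! ### Hard thresholding pursuit -/

section HTP

variable {m n : ℕ}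

/-- `Φ` nearly preserves inner products of vectors with a common support of size `k`. -/
def NearIsometry (Φ : Matrix (Fin m) (Fin n) ℂ) (k : ℕ) (ε : ℝ) : Prop :=
  ∀ I : Finset (Fin n), I.card ≤ k → ∀ x y : Fin n → ℂ, (∀ i, i ∉ I → x i = 0) →
    (∀ i, i ∉ I → y i = 0) →
    ‖star (Φ *ᵥ x) ⬝ᵥ (Φ *ᵥ y) - star x ⬝ᵥ y‖ ≤ ε * (l2norm x * l2norm y)

/-- The correlation of `e` with the image under `Φ` of a `k`-sparse vector `x` is at most
`η ‖x‖`. -/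
def WeakNoise (Φ : Matrix (Fin m) (Fin n) ℂ) (e : Fin m → ℂ) (k : ℕ) (η : ℝ) : Prop :=
  ∀ I : Finset (Fin n), I.card ≤ k → ∀ x : Fin n → ℂ, (∀ i, i ∉ I → x i = 0) →
    ‖star (Φ *ᵥ x) ⬝ᵥ e‖ ≤ η * l2norm x

variable {Φ : Matrix (Fin m) (Fin n) ℂ} {b : Fin m → ℂ} {J : Set (Fin n)} {x x' : Fin n → ℂ}
  {ε η : ℝ} {s : ℕ}

theorem IsLeastSquaresOn.orthogonal (h : IsLeastSquaresOn Φ b J x) {w : Fin n → ℂ}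
    (hw : ∀ i, i ∉ J → w i = 0) : star (Φ *ᵥ w) ⬝ᵥ (b - Φ *ᵥ x) = 0 := by
  refine star_dotProduct_eq_zero_of_le fun c => ?_
  have := h.2 (x + c • w) fun i hi => by simp [h.1 i hi, hw i hi]
  rwa [Matrix.mulVec_add, Matrix.mulVec_smul, ← sub_sub] at this

/-- Error of least squares on a set `J` in terms of the part of the target outside `J`. -/
theorem IsLeastSquaresOn.error_le {e : Fin m → ℂ} {I : Finset (Fin n)} {k : ℕ}
    (h : IsLeastSquaresOn Φ b J x') (hε : 0 ≤ ε) (hη : 0 ≤ η) (hb : b = Φ *ᵥ x + e) (hΦ : NearIsometry Φ k ε)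
    (he : WeakNoise Φ e k η) (hI : I.card ≤ k) (hx : ∀ i, i ∉ I → x i = 0)
    (hJ : J ⊆ I) :
    (1 - ε) * l2norm (x - x') ≤ l2norm (Jᶜ.indicator x) + η := by
  classical
  set d := x - x' with hd
  have hdI : ∀ i, i ∉ I → d i = 0 := fun i hi => by
    simp [hd, hx i hi, h.1 i fun hJi => hi (hJ hJi)]
  set w := J.indicator d with hw
  have hwI : ∀ i, i ∉ I → w i = 0 := fun i hi =>
    Set.indicator_of_notMem (fun hJi => hi (hJ hJi)) _
  have h0 := h.orthogonal (w := w) fun i hi => Set.indicator_of_notMem hi _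
  have hbd : b - Φ *ᵥ x' = Φ *ᵥ d + e := by rw [hb, hd, Matrix.mulVec_sub]; abel
  rw [hbd, dotProduct_add] at h0
  have h1 := hΦ I hI w d hwI hdI
  have h2 := he I hI w hwI
  -- Orthogonality of the residual replaces `⟨Φw, Φd⟩` by `-⟨Φw, e⟩`, and `⟨w, d⟩ = ‖w‖²` because
  -- `w` is a restriction of `d`. So the error on `J` is at most `η + ε ‖d‖`.
  rw [eq_neg_of_add_eq_zero_left h0, ← l2norm_indicator_sq, ← hw, ← neg_add', norm_neg] at h1
  have h3 : l2norm w ^ 2 ≤ (η + ε * l2norm d) * l2norm w := by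
    calc l2norm w ^ 2 = ‖((l2norm w : ℂ)) ^ 2‖ := by simp
      _ ≤ ‖star (Φ *ᵥ w) ⬝ᵥ e + (l2norm w : ℂ) ^ 2‖ + ‖star (Φ *ᵥ w) ⬝ᵥ e‖ := by
        have := norm_sub_le (star (Φ *ᵥ w) ⬝ᵥ e + (l2norm w : ℂ) ^ 2) (star (Φ *ᵥ w) ⬝ᵥ e)
        rwa [add_sub_cancel_left] at this
      _ ≤ _ := by linarith
  have h4 : l2norm d ≤ l2norm w + l2norm (Jᶜ.indicator x) := by
    have : d = w + Jᶜ.indicator x := by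
      ext i
      by_cases hi : i ∈ J
      · simp [hw, hi]
      · simp [hw, hi, hd, h.1 i hi]
    calc l2norm d = l2norm (w + Jᶜ.indicator x) := by rw [← this]
      _ ≤ _ := l2norm_add_le _ _
  have h5 : l2norm w ≤ η + ε * l2norm d := by
    rcases (l2norm_nonneg w).eq_or_lt with h | h
    · rw [← h]; have := l2norm_nonneg d; positivity
    · rw [sq] at h3; exact le_of_mul_le_mul_right h3 h
  linarith

/-- The part of an `s`-sparse vector that is missed by the support of a best `s`-term
approximation of `y` is controlled by `y - x`. -/
theorem IsHardThresholdSupport.missed_le {y : Fin n → ℂ} (h : IsHardThresholdSupport s y J)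
    {S : Finset (Fin n)} (hS : S.card ≤ s) (hx : ∀ i, i ∉ S → x i = 0) :
    ∃ T : Finset (Fin n), T.card = s ∧ J ⊆ T ∧
      l2norm (Jᶜ.indicator x) ≤ 2 * l2norm (((S ∪ T : Finset (Fin n)) : Set (Fin n)).indicator (y - x)) := by
  classical
  obtain ⟨T, hT, hmax, rfl⟩ := h
  refine ⟨T, hT, fun i hi => hi.1, ?_⟩
  set J : Set (Fin n) := {i | i ∈ T ∧ y i ≠ 0} with hJ
  -- Indices of `S` that were not selected are at most as many as selected indices outside `S`, and
  -- each carries a smaller entry of `y`. On `T \ S` the vector `x` vanishes, so `y` is pure error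
  -- there.
  have hcard : (S \ T).card ≤ (T \ S).card := by
    have h1 := Finset.card_sdiff_add_card_inter S T
    have h2 := Finset.card_sdiff_add_card_inter T S
    rw [Finset.inter_comm] at h2
    omega
  have hsum : ∑ i ∈ S \ T, ‖y i‖ ^ 2 ≤ ∑ i ∈ T \ S, ‖y i‖ ^ 2 := by
    rcases (S \ T).eq_empty_or_nonempty with h0 | h0
    · rw [h0]; simp only [Finset.sum_empty]; positivity
    obtain ⟨j, hj, hjmax⟩ := Finset.exists_max_image (S \ T) (fun i => ‖y i‖ ^ 2) h0
    calc ∑ i ∈ S \ T, ‖y i‖ ^ 2 ≤ (S \ T).card • ‖y j‖ ^ 2 := Finset.sum_le_card_nsmul _ _ _ hjmax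
      _ ≤ (T \ S).card • ‖y j‖ ^ 2 := nsmul_le_nsmul_left (by positivity) hcard
      _ ≤ _ := Finset.card_nsmul_le_sum _ _ _ fun i hi =>
        pow_le_pow_left₀ (norm_nonneg _)
          (hmax i (Finset.mem_sdiff.1 hi).1 j (Finset.mem_sdiff.1 hj).2) 2
  have hind : ∀ (A : Finset (Fin n)) (z : Fin n → ℂ),
      l2norm ((A : Set (Fin n)).indicator z) ^ 2 = ∑ i ∈ A, ‖z i‖ ^ 2 := by
    intro A z
    rw [l2norm_sq, ← Finset.sum_indicator_subset _ (Finset.subset_univ A)]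
    refine Finset.sum_congr rfl fun i _ => ?_
    by_cases hi : i ∈ A <;> simp [hi]
  have hy : l2norm (((S \ T : Finset (Fin n)) : Set (Fin n)).indicator y)
      ≤ l2norm (((S ∪ T : Finset (Fin n)) : Set (Fin n)).indicator (y - x)) := by
    refine le_of_sq_le_sq ?_ (l2norm_nonneg _)
    rw [hind, hind]
    calc _ ≤ ∑ i ∈ T \ S, ‖y i‖ ^ 2 := hsum
      _ = ∑ i ∈ T \ S, ‖(y - x) i‖ ^ 2 := Finset.sum_congr rfl fun i hi => by
          simp [hx i (Finset.mem_sdiff.1 hi).2]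
      _ ≤ _ := Finset.sum_le_sum_of_subset_of_nonneg
          (Finset.sdiff_subset.trans Finset.subset_union_right) fun _ _ _ => by positivity
  -- Write `x = y - (y - x)` on `S` outside `J`. The indices of `S ∩ T` outside `J` are exactly
  -- those with `y i = 0`, so `y` only contributes on `S \ T`.
  have hdec : Jᶜ.indicator x = ((S \ T : Finset (Fin n)) : Set (Fin n)).indicator y
      - (Jᶜ ∩ S).indicator (y - x) := by
    ext i
    by_cases hiS : i ∈ S
    · by_cases hiT : i ∈ T
      · by_cases hyi : y i = 0
        · simp [hJ, hiS, hiT, hyi, Set.indicator]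
        · simp [hJ, hiS, hiT, hyi, Set.indicator]
      · simp [hJ, hiS, hiT, Set.indicator]
    · simp [hiS, Set.indicator, hx i hiS]
  rw [hdec, two_mul]
  refine (l2norm_sub_le _ _).trans (add_le_add hy (l2norm_indicator_mono ?_ _))
  intro i hi
  exact Finset.mem_coe.2 (Finset.mem_union_left _ hi.2)

/-- One step of hard thresholding pursuit. -/
theorem IsHTPStep.missed_le {e : Fin m → ℂ} {S : Finset (Fin n)} {T₀ : Finset (Fin n)}
    {ξ : Fin n → ℂ} (hε : 0 ≤ ε) (hη : 0 ≤ η) (hb : b = Φ *ᵥ x + e)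
    (hΦ : NearIsometry Φ (3 * s) ε) (he : WeakNoise Φ e (2 * s) η) (hS : S.card ≤ s)
    (hx : ∀ i, i ∉ S → x i = 0) (hT₀ : T₀.card ≤ s) (hξ : ∀ i, i ∉ T₀ → ξ i = 0)
    (h : IsHardThresholdSupport s (ξ + Φᴴ *ᵥ (b - Φ *ᵥ ξ)) J) :
    ∃ T : Finset (Fin n), T.card = s ∧ J ⊆ T ∧
      l2norm (Jᶜ.indicator x) ≤ 2 * (ε * l2norm (x - ξ) + η) := by
  classical
  obtain ⟨T, hT, hJT, hle⟩ := h.missed_le hS hx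
  refine ⟨T, hT, hJT, hle.trans (mul_le_mul_of_nonneg_left ?_ zero_le_two)⟩
  set d := ξ + Φᴴ *ᵥ (b - Φ *ᵥ ξ) - x with hd
  set A : Set (Fin n) := ((S ∪ T : Finset (Fin n)) : Set (Fin n)) with hA
  set w := A.indicator d with hw
  set g := x - ξ with hg
  have hdg : d = Φᴴ *ᵥ (Φ *ᵥ g + e) - g := by
    rw [hd, hb, hg, Matrix.mulVec_sub Φ]
    rw [show Φ *ᵥ x + e - Φ *ᵥ ξ = Φ *ᵥ x - Φ *ᵥ ξ + e by abel]
    abel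
  have hwST : ∀ i, i ∉ S ∪ T → w i = 0 := fun i hi =>
    Set.indicator_of_notMem (by simpa [hA] using hi) _
  have hcard : (S ∪ T).card ≤ 2 * s := (Finset.card_union_le _ _).trans (by omega)
  -- The level `3 s`: target, new support and support of the previous iterate. The noise is only
  -- tested on `S ∪ T`, hence `2 s` in `WeakNoise`.
  have hcard' : (S ∪ T ∪ T₀).card ≤ 3 * s := (Finset.card_union_le _ _).trans (by omega)
  have h1 := hΦ (S ∪ T ∪ T₀) hcard' w g
    (fun i hi => hwST i fun h => hi (Finset.mem_union_left _ h)) (fun i hi => by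
      simp only [Finset.mem_union, not_or] at hi
      simp [hg, hx i hi.1.1, hξ i hi.2])
  have h2 := he (S ∪ T) hcard w hwST
  have h3 : ((l2norm w ^ 2 : ℝ) : ℂ)
      = (star (Φ *ᵥ w) ⬝ᵥ (Φ *ᵥ g) - star w ⬝ᵥ g) + star (Φ *ᵥ w) ⬝ᵥ e := by
    rw [Complex.ofReal_pow, hw, l2norm_indicator_sq, ← hw, hdg, dotProduct_sub,
      Matrix.dotProduct_mulVec, ← Matrix.star_mulVec, dotProduct_add]
    ring
  have h4 : l2norm w ^ 2 ≤ (ε * l2norm g + η) * l2norm w := by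
    calc l2norm w ^ 2 = ‖((l2norm w ^ 2 : ℝ) : ℂ)‖ := by simp
      _ ≤ ‖star (Φ *ᵥ w) ⬝ᵥ (Φ *ᵥ g) - star w ⬝ᵥ g‖ + ‖star (Φ *ᵥ w) ⬝ᵥ e‖ := by
        rw [h3]; exact norm_add_le _ _
      _ ≤ _ := by linarith
  rcases (l2norm_nonneg w).eq_or_lt with h | h
  · rw [← h]; have := l2norm_nonneg g; positivity
  · rw [sq] at h4; exact le_of_mul_le_mul_right h4 h

/-- Since `R` halves at each step, the sum of `1 / R` up to an index `k` is at most `2 / R k`.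
Taking for `k` the last index where `f` is nonzero, where `A ≤ R k`, bounds the sum by 2
independently of `N` and `A`. -/
theorem sum_div_le_two_of_halving {A : ℝ} (hA : 0 ≤ A) {R f : ℕ → ℝ} {N : ℕ}
    (hR : ∀ k ≤ N, 0 < R k) (hhalf : ∀ k < N, R (k + 1) ≤ R k / 2)
    (hf : ∀ k ≤ N, f k = 0 ∨ f k = A ∧ A ≤ R k) :
    ∑ k ∈ Finset.range (N + 1), f k / R k ≤ 2 := by
  have hG : ∀ k ≤ N, ∑ i ∈ Finset.range (k + 1), 1 / R i ≤ 2 / R k := by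
    intro k
    induction k with
    | zero =>
      intro h
      have := hR 0 h
      simp only [zero_add, Finset.range_one, Finset.sum_singleton]
      gcongr; norm_num
    | succ k ih =>
      intro h
      rw [Finset.sum_range_succ]
      have h1 := ih (by omega)
      have h2 := hR (k + 1) h
      have h3 := hR k (by omega)
      have h4 : 2 / R k ≤ 1 / R (k + 1) := by
        rw [div_le_div_iff₀ h3 h2]; linarith [hhalf k (by omega)]
      calc _ ≤ 1 / R (k + 1) + 1 / R (k + 1) := by linarith
        _ = 2 / R (k + 1) := by ring
  have hS : ∀ k ≤ N, ∑ i ∈ Finset.range (k + 1), f i / R i ≤ 2 := by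
    intro k
    induction k with
    | zero =>
      intro h
      have := hR 0 h
      simp only [zero_add, Finset.range_one, Finset.sum_singleton]
      rw [div_le_iff₀ this]
      rcases hf 0 h with h | h
      · rw [h]; positivity
      · rw [h.1]; linarith [h.2]
    | succ k ih =>
      intro h
      rcases hf (k + 1) h with h0 | h0
      · rw [Finset.sum_range_succ, h0, zero_div, add_zero]; exact ih (by omega)
      · calc ∑ i ∈ Finset.range (k + 1 + 1), f i / R i
            ≤ ∑ i ∈ Finset.range (k + 1 + 1), A * (1 / R i) := by
              refine Finset.sum_le_sum fun i hi => ?_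
              have hi' : i ≤ N := by have := Finset.mem_range.1 hi; omega
              have := hR i hi'
              rw [mul_one_div]
              gcongr
              rcases hf i hi' with h | h
              · rw [h]; exact hA
              · exact h.1.le
          _ ≤ A * (2 / R (k + 1)) := by
              rw [← Finset.mul_sum]; exact mul_le_mul_of_nonneg_left (hG _ h) hA
          _ ≤ 2 := by
              have := hR _ h
              rw [mul_div_assoc', div_le_iff₀ this]; linarith [h0.2]
  exact hS N le_rfl

/-- If the missed part of an `s`-sparse vector shrinks by a constant factor whenever it is larger
than `a`, then it is at most `a` after at most `2 s` steps. -/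
theorem exists_missed_le {S : Finset (Fin n)} (hS : S.card ≤ s) (hx : ∀ i, i ∉ S → x i = 0)
    (J : ℕ → Set (Fin n)) {a : ℝ} (ha : 0 ≤ a)
    (h : ∀ k, a < l2norm ((J k)ᶜ.indicator x) →
      l2norm ((J (k + 1))ᶜ.indicator x) ≤ 7 / 10 * l2norm ((J k)ᶜ.indicator x)) :
    ∃ k ≤ 2 * s, l2norm ((J k)ᶜ.indicator x) ≤ a := by
  classical
  by_contra! hcon
  set R : ℕ → ℝ := fun k => l2norm ((J k)ᶜ.indicator x) ^ 2 with hRdef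
  have hR : ∀ k ≤ 2 * s, 0 < R k := fun k hk => pow_pos (ha.trans_lt (hcon k hk)) 2
  have hhalf : ∀ k < 2 * s, R (k + 1) ≤ R k / 2 := fun k hk => by
    have h1 := h k (hcon k hk.le)
    have h2 := pow_le_pow_left₀ (l2norm_nonneg _) h1 2
    have h3 := hR k hk.le
    simp only [hRdef] at h3 ⊢
    rw [mul_pow] at h2
    linarith
  have hexp : ∀ k, R k = ∑ j ∈ S, ‖(J k)ᶜ.indicator x j‖ ^ 2 := fun k => by
    rw [hRdef]; simp only
    rw [l2norm_sq]
    refine (Finset.sum_subset (Finset.subset_univ S) fun j _ hj => ?_).symm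
    simp [Set.indicator, hx j hj]
  -- Double count: for each `k` the shares `‖x j‖² / R k` of the missed indices add up to 1, while
  -- each `j` in `S` collects at most 2 over all `k`. If no step up to `2 s` were good, this would
  -- give `2 s + 1 ≤ 2 s`.
  have hsum : ∑ k ∈ Finset.range (2 * s + 1), (1 : ℝ) ≤ 2 * s := by
    calc ∑ k ∈ Finset.range (2 * s + 1), (1 : ℝ)
        = ∑ k ∈ Finset.range (2 * s + 1), ∑ j ∈ S, ‖(J k)ᶜ.indicator x j‖ ^ 2 / R k := by
          refine Finset.sum_congr rfl fun k hk => ?_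
          rw [← Finset.sum_div, ← hexp, div_self (hR k (by have := Finset.mem_range.1 hk; omega)).ne']
      _ = ∑ j ∈ S, ∑ k ∈ Finset.range (2 * s + 1), ‖(J k)ᶜ.indicator x j‖ ^ 2 / R k :=
          Finset.sum_comm
      _ ≤ ∑ j ∈ S, 2 := by
          refine Finset.sum_le_sum fun j _ => ?_
          refine sum_div_le_two_of_halving (A := ‖x j‖ ^ 2) (by positivity) hR hhalf fun k _ => ?_
          by_cases hj : j ∈ (J k)ᶜ
          · right
            refine ⟨by rw [Set.indicator_of_mem hj], ?_⟩
            rw [hRdef]; simp only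
            rw [l2norm_sq]
            have := Finset.single_le_sum (f := fun i => ‖(J k)ᶜ.indicator x i‖ ^ 2)
              (fun i _ => by positivity) (Finset.mem_univ j)
            simpa only [Set.indicator_of_mem hj] using this
          · left; rw [Set.indicator_of_notMem hj]; simp
      _ ≤ 2 * s := by
          rw [Finset.sum_const, nsmul_eq_mul]
          have : (S.card : ℝ) ≤ s := by exact_mod_cast hS
          linarith
  rw [Finset.sum_const, Finset.card_range, nsmul_eq_mul] at hsum
  push_cast at hsum
  linarith

/-- Hard thresholding pursuit recovers an `s`-sparse vector up to the noise level after at most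
`2 s` iterations. -/
theorem IsHTPOutput.error_le {e : Fin m → ℂ} {S : Finset (Fin n)} {N : ℕ} {w : Fin n → ℂ}
    (h : IsHTPOutput Φ b s N w) (hN : 1 + 2 * s ≤ N) (hε : 0 ≤ ε) (hε' : ε ≤ 1 / 100)
    (hη : 0 ≤ η) (hb : b = Φ *ᵥ x + e)
    (hΦ : NearIsometry Φ (3 * s) ε) (he : WeakNoise Φ e (2 * s) η) (hS : S.card ≤ s)
    (hx : ∀ i, i ∉ S → x i = 0) :
    (∃ T : Finset (Fin n), T.card ≤ s ∧ ∀ i, i ∉ T → w i = 0) ∧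
      l2norm (x - w) ≤ 41 / 10 * η := by
  classical
  obtain ⟨ξ, k, hk, h0, hstep, rfl⟩ := h
  choose K hK hLS using hstep
  -- `J k` is the set on which `ξ k` is a least squares solution; the start `ξ 0 = 0` gets `∅`, so
  -- that everything is missed at first.
  set J : ℕ → Set (Fin n) := fun k => Nat.casesOn k ∅ K with hJ
  have hΦ2 : NearIsometry Φ (2 * s) ε := fun I hI => hΦ I (hI.trans (by omega))
  have herr : ∀ (T : Finset (Fin n)) (J : Set (Fin n)) (w : Fin n → ℂ), T.card ≤ s → J ⊆ T →
      IsLeastSquaresOn Φ b J w → (1 - ε) * l2norm (x - w) ≤ l2norm (Jᶜ.indicator x) + η := by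
    intro T J w hT hJ hw
    refine hw.error_le (I := S ∪ T) (k := 2 * s) hε hη hb hΦ2 he
      ((Finset.card_union_le _ _).trans (by omega)) (fun i hi => hx i fun h => hi ?_) ?_
    · exact Finset.mem_union_left _ h
    · exact fun i hi => Finset.mem_coe.2 (Finset.mem_union_right _ (hJ hi))
  have hsupp : ∀ k, ∃ T : Finset (Fin n), T.card ≤ s ∧ J k ⊆ T ∧ (∀ i, i ∉ T → ξ k i = 0) ∧
      (1 - ε) * l2norm (x - ξ k) ≤ l2norm ((J k)ᶜ.indicator x) + η := by
    intro k
    cases k with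
    | zero => exact ⟨∅, by simp, by simp [hJ], fun i _ => by simp [h0], by
        simp [hJ, h0]; nlinarith [l2norm_nonneg x]⟩
    | succ k =>
      obtain ⟨T, hT, -, hTJ⟩ := id (hK k)
      have hKT : K k ⊆ T := fun i hi => by rw [hTJ] at hi; exact hi.1
      exact ⟨T, hT.le, hKT, fun i hi => (hLS k).1 i fun h => hi (hKT h),
        herr T (K k) _ hT.le hKT (hLS k)⟩
  have hrec : ∀ k, l2norm ((J (k + 1))ᶜ.indicator x)
      ≤ 2 * (ε * l2norm (x - ξ k) + η) := by
    intro k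
    obtain ⟨T, hT, hJT, hξ, -⟩ := hsupp k
    obtain ⟨-, -, -, h⟩ := IsHTPStep.missed_le hε hη hb hΦ he hS hx hT hξ (hK k)
    exact h
  have hrec' : ∀ k, l2norm ((J (k + 1))ᶜ.indicator x)
      ≤ 3 / 100 * l2norm ((J k)ᶜ.indicator x) + 203 / 100 * η := by
    intro k
    obtain ⟨-, -, -, -, h1⟩ := hsupp k
    have h2 := hrec k
    have h3 := l2norm_nonneg (x - ξ k)
    nlinarith [l2norm_nonneg ((J k)ᶜ.indicator x)]
  -- Above the threshold `3.05 η` the recursion `0.03 · + 2.03 η` contracts by `0.7`, and `0.7² ≤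
  -- 1/2`. Below it the recursion stays below, so every later iterate is good too. Finally `(3.05 +
  -- 1) / 0.99 ≤ 4.1`.
  obtain ⟨k₀, hk₀, hsmall⟩ := exists_missed_le hS hx J (a := 305 / 100 * η) (by positivity)
    fun k hk => by linarith [hrec' k]
  have hstay : ∀ j, l2norm ((J (k₀ + j))ᶜ.indicator x) ≤ 305 / 100 * η := by
    intro j
    induction j with
    | zero => exact hsmall
    | succ j ih => have := hrec' (k₀ + j); rw [← add_assoc]; linarith
  obtain ⟨T, hT, -, hξ, hE⟩ := hsupp k
  refine ⟨⟨T, hT, hξ⟩, ?_⟩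
  have h1 := hstay (k - k₀)
  rw [Nat.add_sub_cancel' (by omega)] at h1
  nlinarith [l2norm_nonneg (x - ξ k)]

/-- One factor update recovers an `s`-sparse vector up to the noise level. -/
theorem IsFactorUpdate.error_le {e : Fin m → ℂ} {S : Finset (Fin n)} {N : ℕ} {w : Fin n → ℂ}
    (h : IsFactorUpdate Φ b s N w) (hs : s ≤ n) (hN : 1 + 2 * s ≤ N) (hε : 0 ≤ ε)
    (hε' : ε ≤ 1 / 100) (hη : 0 ≤ η) (hb : b = Φ *ᵥ x + e)
    (hΦ : NearIsometry Φ (3 * s) ε) (he : WeakNoise Φ e (2 * s) η) (hS : S.card ≤ s)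
    (hx : ∀ i, i ∉ S → x i = 0) :
    (∃ T : Finset (Fin n), T.card ≤ s ∧ ∀ i, i ∉ T → w i = 0) ∧
      l2norm (x - w) ≤ 41 / 10 * η := by
  classical
  rw [IsFactorUpdate] at h
  split_ifs at h with hlt
  · exact h.error_le hN hε hε' hη hb hΦ he hS hx
  · obtain rfl : s = n := le_antisymm hs (not_lt.1 hlt)
    refine ⟨⟨Finset.univ, by simp, fun i hi => absurd (Finset.mem_univ i) hi⟩, ?_⟩
    have := h.error_le (I := Finset.univ) (k := 2 * s) hε hη hb
      (fun I hI => hΦ I (hI.trans (by omega))) he (by simp; omega)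
      (fun i hi => absurd (Finset.mem_univ i) hi) (by simp)
    simp only [Set.compl_univ, Set.indicator_empty] at this
    have h0 : l2norm (fun _ : Fin s => (0 : ℂ)) = 0 := l2norm_zero
    rw [h0] at this
    nlinarith [l2norm_nonneg (x - w)]

end HTP

end SparsePF

namespace SparsePF

/-! ### Rank-one matrices and the measurement operator -/

section Outer

variable {m n₁ n₂ : ℕ} (M : Fin m → Matrix (Fin n₁) (Fin n₂) ℂ)

theorem outer_apply (x : Fin n₁ → ℂ) (y : Fin n₂ → ℂ) (i : Fin n₁) (j : Fin n₂) :
    outer x y i j = x i * star (y j) := rfl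

theorem outer_add_left (x x' : Fin n₁ → ℂ) (y : Fin n₂ → ℂ) :
    outer (x + x') y = outer x y + outer x' y := by
  ext i j; simp [outer_apply, add_mul]

theorem outer_smul_left (c : ℂ) (x : Fin n₁ → ℂ) (y : Fin n₂ → ℂ) :
    outer (c • x) y = c • outer x y := by
  ext i j; simp [outer_apply, mul_assoc]

theorem outer_add_right (x : Fin n₁ → ℂ) (y y' : Fin n₂ → ℂ) :
    outer x (y + y') = outer x y + outer x y' := by
  ext i j; simp [outer_apply, mul_add]

theorem outer_smul_right (c : ℂ) (x : Fin n₁ → ℂ) (y : Fin n₂ → ℂ) :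
    outer x (c • y) = star c • outer x y := by
  ext i j; simp [outer_apply]; ring

theorem outer_sub_left (x x' : Fin n₁ → ℂ) (y : Fin n₂ → ℂ) :
    outer (x - x') y = outer x y - outer x' y := by
  ext i j; simp [outer_apply, sub_mul]

theorem outer_sub_right (x : Fin n₁ → ℂ) (y y' : Fin n₂ → ℂ) :
    outer x (y - y') = outer x y - outer x y' := by
  ext i j; simp [outer_apply, mul_sub]

theorem outer_conjTranspose (x : Fin n₁ → ℂ) (y : Fin n₂ → ℂ) : (outer x y)ᴴ = outer y x := by
  ext i j; simp [outer_apply, mul_comm]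

theorem sensing_add (Z Z' : Matrix (Fin n₁) (Fin n₂) ℂ) :
    sensing M (Z + Z') = sensing M Z + sensing M Z' := by
  ext l; simp [sensing, Matrix.mul_add]

theorem sensing_smul (c : ℂ) (Z : Matrix (Fin n₁) (Fin n₂) ℂ) :
    sensing M (c • Z) = c • sensing M Z := by
  ext l; simp [sensing]

theorem sensing_sum {ι : Type*} (s : Finset ι) (Z : ι → Matrix (Fin n₁) (Fin n₂) ℂ) :
    sensing M (∑ a ∈ s, Z a) = ∑ a ∈ s, sensing M (Z a) := by
  ext l; simp [sensing, Matrix.mul_sum, Matrix.trace_sum]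

theorem sensing_outer_apply (x : Fin n₁ → ℂ) (y : Fin n₂ → ℂ) (l : Fin m) :
    sensing M (outer x y) l = star y ⬝ᵥ ((M l)ᴴ *ᵥ x) := by
  rw [sensing, outer, Matrix.mul_vecMulVec, Matrix.trace_vecMulVec, dotProduct_comm]

theorem opF_mulVec (x : Fin n₁ → ℂ) (y : Fin n₂ → ℂ) :
    opF M y *ᵥ x = sensing M (outer x y) := by
  ext l
  rw [sensing_outer_apply, Matrix.dotProduct_mulVec]; rfl

theorem opG_eq_opF (x : Fin n₁ → ℂ) : opG M x = opF (fun l => (M l)ᴴ) x := by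
  simp [opG, opF]

theorem sensing_conjTranspose (Z : Matrix (Fin n₁) (Fin n₂) ℂ) :
    sensing (fun l => (M l)ᴴ) Zᴴ = star (sensing M Z) := by
  ext l
  simp only [sensing, Pi.star_apply]
  rw [← Matrix.trace_conjTranspose, Matrix.conjTranspose_mul, Matrix.conjTranspose_conjTranspose,
    Matrix.trace_mul_comm]

theorem star_dotProduct_sensingAdj (b : Fin m → ℂ) (x : Fin n₁ → ℂ) (y : Fin n₂ → ℂ) :
    star x ⬝ᵥ (sensingAdj M b *ᵥ y) = star (sensing M (outer x y)) ⬝ᵥ b := by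
  rw [sensingAdj, Matrix.sum_mulVec, dotProduct_sum, dotProduct]
  refine Finset.sum_congr rfl fun l _ => ?_
  rw [Pi.star_apply, sensing_outer_apply, star_star_dotProduct, Matrix.star_mulVec,
    Matrix.conjTranspose_conjTranspose, ← Matrix.dotProduct_mulVec, Matrix.smul_mulVec,
    dotProduct_smul, smul_eq_mul, mul_comm]

attribute [local instance] Matrix.frobeniusNormedAddCommGroup

theorem frobNorm_eq_norm (Z : Matrix (Fin n₁) (Fin n₂) ℂ) : frobNorm Z = ‖Z‖ := by
  rw [Matrix.frobenius_norm_def, frobNorm, Real.sqrt_eq_rpow]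
  simp

theorem frobNorm_sub_le (Z Z' : Matrix (Fin n₁) (Fin n₂) ℂ) :
    frobNorm (Z - Z') ≤ frobNorm Z + frobNorm Z' := by
  simpa only [frobNorm_eq_norm] using norm_sub_le Z Z'

theorem frobNorm_sq (Z : Matrix (Fin n₁) (Fin n₂) ℂ) : frobNorm Z ^ 2 = ∑ j, ∑ k, ‖Z j k‖ ^ 2 :=
  Real.sq_sqrt (by positivity)

theorem frobNorm_nonneg (Z : Matrix (Fin n₁) (Fin n₂) ℂ) : 0 ≤ frobNorm Z := Real.sqrt_nonneg _

theorem frobNorm_outer (x : Fin n₁ → ℂ) (y : Fin n₂ → ℂ) :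
    frobNorm (outer x y) = l2norm x * l2norm y := by
  rw [← sq_eq_sq₀ (frobNorm_nonneg _) (mul_nonneg (l2norm_nonneg _) (l2norm_nonneg _)), frobNorm_sq,
    mul_pow, l2norm_sq, l2norm_sq, Finset.sum_mul_sum]
  simp [outer_apply, mul_pow]

theorem frobNorm_smul (c : ℂ) (Z : Matrix (Fin n₁) (Fin n₂) ℂ) :
    frobNorm (c • Z) = ‖c‖ * frobNorm Z := by
  rw [← sq_eq_sq₀ (frobNorm_nonneg _) (mul_nonneg (norm_nonneg _) (frobNorm_nonneg _)), frobNorm_sq,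
    mul_pow, frobNorm_sq, Finset.mul_sum]
  simp [mul_pow, Finset.mul_sum]

theorem l2norm_mulVec_le (Z : Matrix (Fin n₁) (Fin n₂) ℂ) (y : Fin n₂ → ℂ) :
    l2norm (Z *ᵥ y) ≤ specNorm Z * l2norm y :=
  (LinearMap.toContinuousLinearMap (Matrix.toEuclideanLin Z)).le_opNorm (WithLp.toLp 2 y)

theorem coordProj_mulVec (J : Finset (Fin n₁)) (x : Fin n₁ → ℂ) :
    coordProj J *ᵥ x = fun i => if i ∈ J then x i else 0 := by
  ext i; simp [coordProj, Matrix.mulVec_diagonal]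

theorem coordProj_mulVec_of_support {J : Finset (Fin n₁)} {x : Fin n₁ → ℂ}
    (h : ∀ i, i ∉ J → x i = 0) : coordProj J *ᵥ x = x := by
  rw [coordProj_mulVec]; ext i
  by_cases hi : i ∈ J <;> simp [hi, h]

theorem coordProj_conjTranspose (J : Finset (Fin n₁)) : (coordProj J)ᴴ = coordProj J := by
  rw [coordProj, Matrix.diagonal_conjTranspose]
  congr 1; ext i; by_cases hi : i ∈ J <;> simp [hi]

/-- The measurement operator nearly preserves inner products of rank-one matrices with common
row support of size `k₁` and column support of size `k₂`. -/
def BilinRIP (k₁ k₂ : ℕ) (ε : ℝ) : Prop :=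
  ∀ (I : Finset (Fin n₁)) (K : Finset (Fin n₂)), I.card ≤ k₁ → K.card ≤ k₂ →
    ∀ (x x' : Fin n₁ → ℂ) (y y' : Fin n₂ → ℂ), (∀ i, i ∉ I → x i = 0) → (∀ i, i ∉ I → x' i = 0) →
      (∀ i, i ∉ K → y i = 0) → (∀ i, i ∉ K → y' i = 0) →
      ‖star (sensing M (outer x y)) ⬝ᵥ sensing M (outer x' y') - (star x ⬝ᵥ x') * (star y' ⬝ᵥ y)‖ ≤
        ε * (l2norm x * l2norm y * l2norm x' * l2norm y')

variable {M} {k₁ k₂ : ℕ} {ε : ℝ}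

/-- `G(x)` is `F(x)` for the adjoint matrices, so this symmetry lets `BilinRIP.factorUpdate` serve
for both half-steps of SPF. -/
theorem BilinRIP.conjTranspose (h : BilinRIP M k₁ k₂ ε) :
    BilinRIP (fun l => (M l)ᴴ) k₂ k₁ ε := by
  intro K I hK hI y y' x x' hy hy' hx hx'
  have := h I K hI hK x' x y' y hx' hx hy' hy
  rw [← outer_conjTranspose x y, ← outer_conjTranspose x' y', sensing_conjTranspose,
    sensing_conjTranspose, star_star, dotProduct_comm]
  rw [mul_comm (star x' ⬝ᵥ x)] at this
  refine this.trans (le_of_eq ?_)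
  ring

theorem BilinRIP.l2norm_sensing_le (h : BilinRIP M k₁ k₂ ε) (hε' : ε ≤ 1 / 100)
    {I : Finset (Fin n₁)} {K : Finset (Fin n₂)} (hI : I.card ≤ k₁) (hK : K.card ≤ k₂)
    {x : Fin n₁ → ℂ} {y : Fin n₂ → ℂ} (hx : ∀ i, i ∉ I → x i = 0) (hy : ∀ i, i ∉ K → y i = 0) :
    l2norm (sensing M (outer x y)) ≤ 101 / 100 * (l2norm x * l2norm y) := by
  have h1 := h I K hI hK x x y y hx hx hy hy
  have hx0 := l2norm_nonneg x
  have hy0 := l2norm_nonneg y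
  rw [star_dotProduct_self, star_dotProduct_self, star_dotProduct_self, ← Complex.ofReal_mul,
    ← Complex.ofReal_sub, Complex.norm_real] at h1
  have h2 := (le_abs_self _).trans h1
  refine le_of_sq_le_sq ?_ (by positivity)
  have h3 : 0 ≤ (l2norm x * l2norm y) ^ 2 := by positivity
  nlinarith

end Outer

/-! ### One factor update and the optimal start -/

section Update

variable {m n₁ n₂ : ℕ} {M : Fin m → Matrix (Fin n₁) (Fin n₂) ℂ} {s₁ s₂ : ℕ} {ε lam : ℝ}
  {u : Fin n₁ → ℂ} {v : Fin n₂ → ℂ} {z b : Fin m → ℂ} {S₁ : Finset (Fin n₁)} {S₂ : Finset (Fin n₂)}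

/-- The sine of the angle between unit vectors `v` and `y`. -/
noncomputable def sinAngle {n : ℕ} (v y : Fin n → ℂ) : ℝ := l2norm (v - (star y ⬝ᵥ v) • y)

/-- The contraction step. With `v = ⟨y, v⟩ y + v'`, the data are `F(y)` applied to a multiple of
`u`, plus the leakage `lam • 𝒜(u v'^*)`, plus `z`. As `v' ⊥ y`, the leakage has correlation at most
`ε · lam · sin` with the range of sparse vectors under `F(y)`, so HTP treats it as weak noise. The
last conclusion reproduces the correlation hypothesis for the other factor. -/
theorem BilinRIP.factorUpdate (hM : BilinRIP M (3 * s₁) (3 * s₂) ε) (hε : 0 ≤ ε)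
    (hε' : ε ≤ 1 / 100) (hlam : 0 < lam) (hu : l2norm u = 1) (hv : l2norm v = 1)
    (hS₁ : S₁.card ≤ s₁) (hS₂ : S₂.card ≤ s₂) (hs₁ : s₁ ≤ n₁)
    (hu' : ∀ i, i ∉ S₁ → u i = 0) (hv' : ∀ i, i ∉ S₂ → v i = 0)
    (hz : l2norm z ≤ 41 / 1000 * lam) (hb : b = sensing M ((lam : ℂ) • outer u v) + z)
    {y : Fin n₂ → ℂ} {K : Finset (Fin n₂)} (hK : K.card ≤ s₂) (hy : l2norm y = 1)
    (hy' : ∀ i, i ∉ K → y i = 0) (hc : 1 / 2 ≤ ‖star v ⬝ᵥ y‖) {N : ℕ} (hN : 1 + 2 * s₁ ≤ N)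
    {w : Fin n₁ → ℂ} (hw : IsFactorUpdate (opF M y) b s₁ N w) :
    (∃ T : Finset (Fin n₁), T.card ≤ s₁ ∧ ∀ i, i ∉ T → w i = 0) ∧ w ≠ 0 ∧
      l2norm (((lam : ℂ) * (star v ⬝ᵥ y)) • u - w) ≤
        41 / 10 * (ε * lam * sinAngle v y + 101 / 100 * l2norm z) ∧
      sinAngle u (normalize w) ≤ 1 / 10 * sinAngle v y + 9 * (l2norm z / lam) ∧
      1 / 2 ≤ ‖star u ⬝ᵥ normalize w‖ := by
  classical
  have hσ := l2norm_sub_proj_sq hy hv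
  set v' := v - (star y ⬝ᵥ v) • y with hvdef
  set σ := sinAngle v y with hσdef
  have hσ' : l2norm v' = σ := rfl
  have hσ0 : 0 ≤ σ := l2norm_nonneg _
  have hσ1 : σ ≤ 1 := by rw [hσ'] at hσ; nlinarith [sq_nonneg ‖star y ⬝ᵥ v‖]
  have hz0 := l2norm_nonneg z
  have hvK : ∀ i, i ∉ K ∪ S₂ → v' i = 0 := fun i hi => by
    simp only [Finset.mem_union, not_or] at hi
    simp [hvdef, hv' i hi.2, hy' i hi.1]
  have hyK : ∀ i, i ∉ K ∪ S₂ → y i = 0 := fun i hi => by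
    simp only [Finset.mem_union, not_or] at hi
    exact hy' i hi.1
  have hKS : (K ∪ S₂).card ≤ 3 * s₂ := (Finset.card_union_le _ _).trans (by omega)
  have hΦ : NearIsometry (opF M y) (3 * s₁) ε := by
    intro I hI x x' hx hx'
    have := hM I K hI (by omega) x x' y y hx hx' hy' hy'
    rw [star_dotProduct_self, hy] at this
    simpa [opF_mulVec] using this
  set e : Fin m → ℂ := (lam : ℂ) • sensing M (outer u v') + z with he
  have hbe : b = opF M y *ᵥ (((lam : ℂ) * (star v ⬝ᵥ y)) • u) + e := by
    have hdec : v = (star y ⬝ᵥ v) • y + v' := by rw [hvdef]; abel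
    have : outer u v = (star v ⬝ᵥ y) • outer u y + outer u v' := by
      conv_lhs => rw [hdec]
      rw [outer_add_right, outer_smul_right, star_star_dotProduct]
    rw [hb, this, Matrix.mulVec_smul, opF_mulVec, he, sensing_smul, sensing_add, sensing_smul,
      smul_add, smul_smul, add_assoc]
  have hnoise : WeakNoise (opF M y) e (2 * s₁) (ε * lam * σ + 101 / 100 * l2norm z) := by
    intro I hI x hx
    rw [opF_mulVec, he, dotProduct_add, dotProduct_smul, smul_eq_mul]
    have h1 := hM (I ∪ S₁) (K ∪ S₂) ((Finset.card_union_le _ _).trans (by omega)) hKS x u y v'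
      (fun i hi => hx i fun h => hi (Finset.mem_union_left _ h))
      (fun i hi => hu' i fun h => hi (Finset.mem_union_right _ h)) hyK hvK
    have h0 : star v' ⬝ᵥ y = 0 := by
      rw [hvdef, star_sub, sub_dotProduct, star_smul, smul_dotProduct, star_star_dotProduct,
        star_dotProduct_self, hy]
      simp
    rw [h0, mul_zero, sub_zero, hy, hu, hσ', mul_one, mul_one] at h1
    have h2 := hM.l2norm_sensing_le hε' (I := I) (K := K) (by omega) (by omega) hx hy'
    have h3 := norm_star_dotProduct_le (sensing M (outer x y)) z
    rw [hy, mul_one] at h2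
    have h4 := h3.trans (mul_le_mul_of_nonneg_right h2 hz0)
    calc _ ≤ lam * ‖star (sensing M (outer x y)) ⬝ᵥ sensing M (outer u v')‖
          + ‖star (sensing M (outer x y)) ⬝ᵥ z‖ := by
          refine (norm_add_le _ _).trans ?_
          rw [norm_mul, Complex.norm_real, Real.norm_of_nonneg hlam.le]
      _ ≤ lam * (ε * (l2norm x * σ)) + 101 / 100 * l2norm x * l2norm z :=
          add_le_add (mul_le_mul_of_nonneg_left h1 hlam.le) h4
      _ = _ := by ring
  obtain ⟨hT, hE⟩ := hw.error_le hs₁ hN hε hε' (by positivity) hbe hΦ hnoise hS₁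
    (fun i hi => by simp [hu' i hi])
  set c := star v ⬝ᵥ y with hcdef
  have hlc : lam / 2 ≤ ‖(lam : ℂ) * c‖ := by
    rw [norm_mul, Complex.norm_real, Real.norm_of_nonneg hlam.le]
    nlinarith
  have hlc0 : (lam : ℂ) * c ≠ 0 := by
    rw [← norm_pos_iff]; linarith
  -- `4.1 (0.01 + 1.01 · 0.041) ≤ 0.22`, below the lower bound `lam / 2` for the length of the
  -- target, so `w ≠ 0` and can be normalized.
  have hEsmall : 41 / 10 * (ε * lam * σ + 101 / 100 * l2norm z) ≤ 22 / 100 * lam := by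
    have : ε * lam * σ ≤ 1 / 100 * lam * 1 := by gcongr
    linarith
  have hw0 : w ≠ 0 := by
    rintro rfl
    rw [sub_zero, l2norm_smul, hu, mul_one] at hE
    linarith
  have hwn := l2norm_normalize hw0
  have hsin : sinAngle u (normalize w) ≤ 1 / 10 * σ + 9 * (l2norm z / lam) := by
    have h1 := l2norm_sub_proj_le hwn u (((lam : ℂ) * c)⁻¹ * (l2norm w : ℂ))
    rw [mul_smul, l2norm_smul_normalize] at h1
    have h2 : u - ((lam : ℂ) * c)⁻¹ • w = ((lam : ℂ) * c)⁻¹ • (((lam : ℂ) * c) • u - w) := by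
      rw [smul_sub, smul_smul, inv_mul_cancel₀ hlc0, one_smul]
    rw [h2, l2norm_smul, norm_inv] at h1
    refine h1.trans ?_
    have h3 : ‖(lam : ℂ) * c‖⁻¹ ≤ (lam / 2)⁻¹ := inv_anti₀ (by positivity) hlc
    calc _ ≤ (lam / 2)⁻¹ * (41 / 10 * (ε * lam * σ + 101 / 100 * l2norm z)) :=
          mul_le_mul h3 hE (l2norm_nonneg _) (by positivity)
      _ = 82 / 10 * (ε * σ) + 8282 / 1000 * (l2norm z / lam) := by field_simp; ring
      _ ≤ _ := by
          have : ε * σ ≤ 1 / 100 * σ := by gcongr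
          have : 0 ≤ l2norm z / lam := by positivity
          linarith
  refine ⟨hT, hw0, hE, hsin, ?_⟩
  have h1 := l2norm_sub_proj_sq hwn hu
  have h2 : l2norm z / lam ≤ 41 / 1000 := by rw [div_le_iff₀ hlam]; exact hz
  -- `0.1 + 9 · 0.041 ≤ 1/2`; then the squared cosine is at least `3/4`, and the invariant `1/2 ≤
  -- cos` persists.
  have h3 : sinAngle u (normalize w) ≤ 1 / 2 := by linarith
  have h4 : 0 ≤ sinAngle u (normalize w) := l2norm_nonneg _
  rw [← sinAngle, norm_star_dotProduct_comm] at h1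
  nlinarith [norm_nonneg (star u ⬝ᵥ normalize w)]

/-- Two estimates of the maximal spectral norm `σ`. Testing with `(u, v)` gives `σ ≥ lam (1 - ε) -
1.01 ‖z‖`. Testing with the singular vectors gives `σ ≤ lam (|⟨v, v₀⟩| + ε) + 1.01 ‖z‖`. With `ε ≤
1/100` and `‖z‖ ≤ 0.041 lam` these exclude a correlation below `1/2`. -/
theorem BilinRIP.optimalStart (hM : BilinRIP M (3 * s₁) (3 * s₂) ε)
    (hε' : ε ≤ 1 / 100) (hlam : 0 < lam) (hu : l2norm u = 1) (hv : l2norm v = 1)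
    (hS₁ : S₁.card ≤ s₁) (hS₂ : S₂.card ≤ s₂) (hs₁ : s₁ ≤ n₁) (hs₂ : s₂ ≤ n₂)
    (hu' : ∀ i, i ∉ S₁ → u i = 0) (hv' : ∀ i, i ∉ S₂ → v i = 0)
    (hz : l2norm z ≤ 41 / 1000 * lam) (hb : b = sensing M ((lam : ℂ) • outer u v) + z)
    {v₀ : Fin n₂ → ℂ} (h : IsOptimalStart s₁ s₂ (sensingAdj M b) v₀) :
    l2norm v₀ = 1 ∧ (∃ K : Finset (Fin n₂), K.card ≤ s₂ ∧ ∀ i, i ∉ K → v₀ i = 0) ∧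
      1 / 2 ≤ ‖star v ⬝ᵥ v₀‖ := by
  classical
  obtain ⟨J₁, J₂, hJ₁, hJ₂, hmax, hv₀, hsing⟩ := h
  obtain ⟨K₁, hSK₁, hK₁⟩ : ∃ K₁ : Finset (Fin n₁), S₁ ⊆ K₁ ∧ K₁.card = s₁ :=
    Finset.exists_superset_card_eq hS₁ (by simpa using hs₁)
  obtain ⟨K₂, hSK₂, hK₂⟩ : ∃ K₂ : Finset (Fin n₂), S₂ ⊆ K₂ ∧ K₂.card = s₂ :=
    Finset.exists_superset_card_eq hS₂ (by simpa using hs₂)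
  have huK : ∀ i, i ∉ K₁ → u i = 0 := fun i hi => hu' i fun h => hi (hSK₁ h)
  have hvK : ∀ i, i ∉ K₂ → v i = 0 := fun i hi => hv' i fun h => hi (hSK₂ h)
  set B := sensingAdj M b with hB
  have hproj : ∀ (A₁ : Finset (Fin n₁)) (A₂ : Finset (Fin n₂)) (x : Fin n₁ → ℂ) (y : Fin n₂ → ℂ),
      (∀ i, i ∉ A₁ → x i = 0) → (∀ i, i ∉ A₂ → y i = 0) →
      star x ⬝ᵥ ((coordProj A₁ * B * coordProj A₂) *ᵥ y) = star (sensing M (outer x y)) ⬝ᵥ b := by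
    intro A₁ A₂ x y hx hy
    rw [← Matrix.mulVec_mulVec, coordProj_mulVec_of_support hy, ← Matrix.mulVec_mulVec,
      Matrix.dotProduct_mulVec]
    have : star x ᵥ* coordProj A₁ = star x := by
      rw [← coordProj_conjTranspose, ← Matrix.star_mulVec, coordProj_mulVec_of_support hx]
    rw [this, star_dotProduct_sensingAdj]
  set P := coordProj J₁ * B * coordProj J₂ with hP
  set σ := specNorm P with hσ
  have hobs : ∀ (x : Fin n₁ → ℂ) (y : Fin n₂ → ℂ), star (sensing M (outer x y)) ⬝ᵥ b
      = lam * (star (sensing M (outer x y)) ⬝ᵥ sensing M (outer u v))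
        + star (sensing M (outer x y)) ⬝ᵥ z := by
    intro x y
    rw [hb, dotProduct_add, sensing_smul, dotProduct_smul, smul_eq_mul]
  have hz0 := l2norm_nonneg z
  have hlow : lam * (1 - ε) - 101 / 100 * l2norm z ≤ σ := by
    have h1 := hM K₁ K₂ (by omega) (by omega) u u v v huK huK hvK hvK
    have h2 := hM.l2norm_sensing_le hε' (I := K₁) (K := K₂) (by omega) (by omega) huK hvK
    have h3 := norm_star_dotProduct_le (sensing M (outer u v)) z
    rw [star_dotProduct_self u, star_dotProduct_self v, hu, hv] at h1
    rw [hu, hv] at h2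
    set a := star (sensing M (outer u v)) ⬝ᵥ sensing M (outer u v) with ha
    have h1' : 1 - ε ≤ ‖a‖ := by
      have := norm_sub_norm_le (1 : ℂ) (1 - a)
      rw [sub_sub_cancel, norm_one, norm_sub_rev] at this
      norm_num at h1
      linarith
    have h4 : l2norm (sensing M (outer u v)) * l2norm z ≤ 101 / 100 * l2norm z :=
      mul_le_mul_of_nonneg_right (by linarith) hz0
    have h5 : lam * ‖a‖ - 101 / 100 * l2norm z ≤ ‖star (sensing M (outer u v)) ⬝ᵥ b‖ := by
      rw [hobs]
      have := norm_sub_le (lam * a + star (sensing M (outer u v)) ⬝ᵥ z)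
        (star (sensing M (outer u v)) ⬝ᵥ z)
      rw [add_sub_cancel_right, norm_mul, Complex.norm_real, Real.norm_of_nonneg hlam.le] at this
      linarith
    have h6 : ‖star (sensing M (outer u v)) ⬝ᵥ b‖ ≤ specNorm (coordProj K₁ * B * coordProj K₂) := by
      rw [← hproj K₁ K₂ u v huK hvK]
      refine (norm_star_dotProduct_le _ _).trans ?_
      rw [hu, one_mul]
      simpa [hv] using l2norm_mulVec_le (coordProj K₁ * B * coordProj K₂) v
    have h7 := hmax K₁ K₂ hK₁ hK₂
    have h8 : lam * (1 - ε) ≤ lam * ‖a‖ := mul_le_mul_of_nonneg_left h1' hlam.le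
    linarith
  have hσpos : 0 < σ := by nlinarith
  set u₀ := P *ᵥ v₀ with hu₀
  have hu₀v₀ : star u₀ ⬝ᵥ (P *ᵥ v₀) = ((σ ^ 2 : ℝ) : ℂ) := by
    rw [hu₀, Matrix.star_mulVec, ← Matrix.dotProduct_mulVec, Matrix.mulVec_mulVec, hsing,
      dotProduct_smul, star_dotProduct_self, hv₀]
    simp
  have hu₀n : l2norm u₀ = σ := by
    rw [star_dotProduct_self] at hu₀v₀
    exact (sq_eq_sq₀ (l2norm_nonneg _) hσpos.le).1 (Complex.ofReal_injective hu₀v₀)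
  have hu₀J : ∀ i, i ∉ J₁ → u₀ i = 0 := fun i hi => by
    rw [hu₀, hP, ← Matrix.mulVec_mulVec, ← Matrix.mulVec_mulVec, coordProj_mulVec]
    simp [hi]
  -- As `σ ≠ 0`, the eigenvector equation places `v₀` in the range of `Pᴴ`, hence of the projection
  -- on `J₂`.
  have hv₀J : ∀ i, i ∉ J₂ → v₀ i = 0 := fun i hi => by
    have h1 : ((σ ^ 2 : ℝ) : ℂ) * v₀ i = 0 := by
      have := congrFun hsing i
      rw [Pi.smul_apply, smul_eq_mul] at this
      rw [← this, ← Matrix.mulVec_mulVec, hP, Matrix.conjTranspose_mul, coordProj_conjTranspose,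
        ← Matrix.mulVec_mulVec, coordProj_mulVec]
      simp [hi]
    rcases mul_eq_zero.1 h1 with h | h
    · exact absurd (Complex.ofReal_eq_zero.1 h) (pow_pos hσpos 2).ne'
    · exact h
  refine ⟨hv₀, ⟨J₂, hJ₂.le, hv₀J⟩, ?_⟩
  rw [hP, hproj J₁ J₂ u₀ v₀ hu₀J hv₀J, hobs] at hu₀v₀
  have h1 := hM (J₁ ∪ K₁) (J₂ ∪ K₂) ((Finset.card_union_le _ _).trans (by omega))
    ((Finset.card_union_le _ _).trans (by omega)) u₀ u v₀ v
    (fun i hi => hu₀J i fun h => hi (Finset.mem_union_left _ h))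
    (fun i hi => huK i fun h => hi (Finset.mem_union_right _ h))
    (fun i hi => hv₀J i fun h => hi (Finset.mem_union_left _ h))
    (fun i hi => hvK i fun h => hi (Finset.mem_union_right _ h))
  have h2 := hM.l2norm_sensing_le hε' (I := J₁) (K := J₂) (by omega) (by omega) hu₀J hv₀J
  have h3 := norm_star_dotProduct_le (sensing M (outer u₀ v₀)) z
  have h4 := norm_star_dotProduct_le u₀ u
  rw [hu₀n, hv₀, hu, hv, mul_one, mul_one, mul_one] at h1
  rw [hu₀n, hv₀, mul_one] at h2
  rw [hu₀n, hu, mul_one] at h4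
  set a := star (sensing M (outer u₀ v₀)) ⬝ᵥ sensing M (outer u v) with ha
  set c := star v ⬝ᵥ v₀ with hc
  have h5 : ‖a‖ ≤ σ * ‖c‖ + ε * σ := by
    calc ‖a‖ = ‖(star u₀ ⬝ᵥ u) * c + (a - (star u₀ ⬝ᵥ u) * c)‖ := by congr 1; ring
      _ ≤ ‖star u₀ ⬝ᵥ u‖ * ‖c‖ + ‖a - (star u₀ ⬝ᵥ u) * c‖ := by
        rw [← norm_mul]; exact norm_add_le _ _
      _ ≤ _ := add_le_add (mul_le_mul_of_nonneg_right h4 (norm_nonneg _)) h1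
  have h6 : σ ^ 2 ≤ lam * ‖a‖ + 101 / 100 * σ * l2norm z := by
    calc σ ^ 2 = ‖((σ ^ 2 : ℝ) : ℂ)‖ := by simp
      _ ≤ lam * ‖a‖ + ‖star (sensing M (outer u₀ v₀)) ⬝ᵥ z‖ := by
        rw [← hu₀v₀]
        refine (norm_add_le _ _).trans ?_
        rw [norm_mul, Complex.norm_real, Real.norm_of_nonneg hlam.le]
      _ ≤ _ := by linarith [mul_le_mul_of_nonneg_right h2 hz0]
  have h7 : σ ≤ lam * (‖c‖ + ε) + 101 / 100 * l2norm z := by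
    refine le_of_mul_le_mul_right ?_ hσpos
    have := mul_le_mul_of_nonneg_left h5 hlam.le
    nlinarith
  by_contra! hlt
  nlinarith

end Update

end SparsePF

namespace SparsePF

/-! ### Stable recovery -/

section Recovery

variable {m n₁ n₂ : ℕ} {M : Fin m → Matrix (Fin n₁) (Fin n₂) ℂ} {s₁ s₂ : ℕ} {ε : ℝ}

theorem exists_support_of_zeroNorm_le {n s : ℕ} {x : Fin n → ℂ} (h : zeroNorm x ≤ s) :
    ∃ S : Finset (Fin n), S.card ≤ s ∧ ∀ i, i ∉ S → x i = 0 := by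
  classical
  refine ⟨Finset.univ.filter fun i => x i ≠ 0, ?_, fun i hi => by simpa using hi⟩
  rw [zeroNorm, Set.ncard_eq_toFinset_card'] at h
  simpa using h

/-- Iterates the contraction from the optimal start. Angles ignore phases, and the phase of `u_t`
cancels in `u_t v_t^*`, because `v_t` is fitted to the normalized `u_t`. -/
theorem BilinRIP.stablyRecovers (hM : BilinRIP M (3 * s₁) (3 * s₂) ε) (hε : 0 ≤ ε)
    (hε' : ε ≤ 1 / 100) (hs₁ : s₁ ≤ n₁) (hs₂ : s₂ ≤ n₂) :
    StablyRecovers M s₁ s₂ (IsOptimalStart s₁ s₂) 1 2 30 := by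
  classical
  intro lam u v X z b hlam hu hv hu0 hv0 hX hb hz N₁ N₂ hN₁ hN₂ v₀ U V hstart hrun
  obtain ⟨S₁, hS₁, hu'⟩ := exists_support_of_zeroNorm_le hu0
  obtain ⟨S₂, hS₂, hv'⟩ := exists_support_of_zeroNorm_le hv0
  have hN₁' : 1 + 2 * s₁ ≤ N₁ := by exact_mod_cast hN₁
  have hN₂' : 1 + 2 * s₂ ≤ N₂ := by exact_mod_cast hN₂
  have hz0 := l2norm_nonneg z
  have hAX : l2norm (sensing M X) ≤ 101 / 100 * lam := by
    have h1 := hM.l2norm_sensing_le hε' (I := S₁) (K := S₂) (by omega) (by omega) hu' hv'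
    rw [hu, hv] at h1
    rw [hX, sensing_smul, l2norm_smul, Complex.norm_real, Real.norm_of_nonneg hlam.le]
    nlinarith
  -- `0.04 · 1.01 ≤ 0.041`: the noise bound relative to `𝒜(X)` becomes one relative to `lam`.
  have hz' : l2norm z ≤ 41 / 1000 * lam := by norm_num at hz; linarith
  have hzAX : l2norm z / lam ≤ 101 / 100 * (l2norm z / l2norm (sensing M X)) := by
    rcases (l2norm_nonneg (sensing M X)).eq_or_lt with h | h
    · rw [← h, mul_zero] at hz
      rw [le_antisymm hz hz0]; simp
    · rw [mul_div_assoc', div_le_div_iff₀ hlam h]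
      nlinarith
  rw [hX] at hb
  have hbs : star b = sensing (fun l => (M l)ᴴ) ((lam : ℂ) • outer v u) + star z := by
    rw [hb, star_add, sensing_smul, sensing_smul, star_smul, ← outer_conjTranspose u v,
      sensing_conjTranspose]
    simp
  set D := l2norm z / lam with hD
  have hD0 : 0 ≤ D := by positivity
  let Good : (Fin n₂ → ℂ) → Prop := fun y => l2norm y = 1 ∧
    (∃ K : Finset (Fin n₂), K.card ≤ s₂ ∧ ∀ i, i ∉ K → y i = 0) ∧ 1 / 2 ≤ ‖star v ⬝ᵥ y‖
  have hstep : ∀ t, Good (normalize (V t)) → Good (normalize (V (t + 1))) ∧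
      sinAngle u (U (t + 1)) ≤ 1 / 10 * sinAngle v (normalize (V t)) + 9 * D ∧
      sinAngle v (normalize (V (t + 1))) ≤ 1 / 10 * sinAngle u (U (t + 1)) + 9 * D ∧
      frobNorm (outer (U (t + 1)) (V (t + 1)) - X) / frobNorm X ≤
        2 * sinAngle u (U (t + 1)) + 5 * D := by
    rintro t ⟨hy, ⟨K, hK, hyK⟩, hc⟩
    obtain ⟨w, hw, hUw⟩ := hrun.left t
    obtain ⟨⟨T, hT, hwT⟩, hw0, -, hsin, hc'⟩ :=
      hM.factorUpdate hε hε' hlam hu hv hS₁ hS₂ hs₁ hu' hv' hz' hb hK hy hyK hc hN₁' hw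
    rw [← hUw] at hsin hc'
    have hU1 : l2norm (U (t + 1)) = 1 := by rw [hUw]; exact l2norm_normalize hw0
    have hUT : ∀ i, i ∉ T → U (t + 1) i = 0 := fun i hi => by rw [hUw]; simp [normalize, hwT i hi]
    have hr := hrun.right t
    rw [opG_eq_opF] at hr
    obtain ⟨⟨T', hT', hVT⟩, hV0, hE, hsin', hc''⟩ :=
      hM.conjTranspose.factorUpdate hε hε' hlam hv hu hS₂ hS₁ hs₂ hv' hu'
        (by rwa [l2norm_star]) hbs hT hU1 hUT hc' hN₂' hr
    rw [l2norm_star] at hE hsin'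
    refine ⟨⟨l2norm_normalize hV0, ⟨T', hT', fun i hi => by simp [normalize, hVT i hi]⟩, hc''⟩,
      hsin, hsin', ?_⟩
    have hXn : frobNorm X = lam := by
      rw [hX, frobNorm_smul, frobNorm_outer, hu, hv, Complex.norm_real,
        Real.norm_of_nonneg hlam.le]; ring
    set p := U (t + 1) with hp
    set y := ((lam : ℂ) * (star u ⬝ᵥ p)) • v with hydef
    set σ := sinAngle u p with hσ
    have hσ0 : 0 ≤ σ := l2norm_nonneg _
    -- `y` is the vector that `V (t + 1)` estimates; `p y^*` is `lam` times the projection of `u` on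
    -- `p`, times `v^*`. The first term is thus the error of the right update, the second the angle
    -- of the left factor.
    have hdec : outer p (V (t + 1)) - X
        = (-1 : ℂ) • outer p (y - V (t + 1))
          - (lam : ℂ) • outer (u - (star p ⬝ᵥ u) • p) v := by
      have h1 : outer p y = ((lam : ℂ) * (star p ⬝ᵥ u)) • outer p v := by
        rw [hydef, outer_smul_right, star_mul', star_star_dotProduct]; simp
      rw [outer_sub_right, h1, outer_sub_left, outer_smul_left, hX]
      module
    rw [hXn, div_le_iff₀ hlam, hdec]
    refine (frobNorm_sub_le _ _).trans ?_
    rw [frobNorm_smul, frobNorm_smul, frobNorm_outer, frobNorm_outer, hv, hU1, Complex.norm_real,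
      Real.norm_of_nonneg hlam.le]
    change ‖(-1 : ℂ)‖ * (1 * l2norm (y - V (t + 1))) + lam * (σ * 1) ≤ _
    have h4 : ε * lam * σ ≤ 1 / 100 * lam * σ := by gcongr
    have h5 : D * lam = l2norm z := by rw [hD]; field_simp
    have h6 : 0 ≤ lam * σ := by positivity
    norm_num
    nlinarith
  have hV0 : Good (normalize (V 0)) := by
    have h := hM.optimalStart hε' hlam hu hv hS₁ hS₂ hs₁ hs₂ hu' hv' hz' hb hstart
    rw [hrun.start, normalize_of_l2norm_eq_one h.1]
    exact h
  -- A full step maps `σ` to at most `0.01 σ + 9.9 D`, whose fixed point is `10 D`.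
  have hind : ∀ t, Good (normalize (V t)) ∧
      sinAngle v (normalize (V t)) ≤ (1 / 10) ^ t + 10 * D := by
    intro t
    induction t with
    | zero =>
      refine ⟨hV0, ?_⟩
      have := l2norm_sub_proj_sq hV0.1 hv
      rw [← sinAngle] at this
      have h1 : sinAngle v (normalize (V 0)) ≤ 1 := by
        nlinarith [sq_nonneg ‖star (normalize (V 0)) ⬝ᵥ v‖]
      rw [pow_zero]; linarith
    | succ t ih =>
      obtain ⟨h1, h2, h3, -⟩ := hstep t ih.1
      refine ⟨h1, ?_⟩
      have h4 : (0 : ℝ) ≤ (1 / 10) ^ t := by positivity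
      rw [pow_succ]
      linarith [ih.2]
  intro δ hδ
  have hlim : Tendsto (fun t : ℕ => 2 * (1 / 10 : ℝ) ^ t) atTop (nhds (2 * 0)) :=
    (tendsto_pow_atTop_nhds_zero_of_lt_one (by norm_num) (by norm_num)).const_mul 2
  rw [mul_zero] at hlim
  have hev := hlim.eventually (gt_mem_nhds hδ)
  obtain ⟨T, hT⟩ := eventually_atTop.1 hev
  refine eventually_atTop.2 ⟨T + 1, fun t ht => ?_⟩
  obtain ⟨k, rfl⟩ : ∃ k, t = k + 1 := ⟨t - 1, by omega⟩
  obtain ⟨h1, h2⟩ := hind k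
  obtain ⟨-, h3, -, h4⟩ := hstep k h1
  have h5 := hT k (by omega)
  have h6 : (0 : ℝ) ≤ (1 / 10) ^ k := by positivity
  have h7 : 0 ≤ l2norm z / l2norm (sensing M X) := div_nonneg hz0 (l2norm_nonneg _)
  -- The error is at most `0.2 · (1/10)^k + 25 D`, and `25 · 1.01 ≤ 30`.
  linarith

end Recovery

/-! ### The restricted isometry property for rank two -/

section RankTwo

variable {m n₁ n₂ : ℕ} {M : Fin m → Matrix (Fin n₁) (Fin n₂) ℂ} {k₁ k₂ : ℕ} {ε : ℝ}

/-- A matrix of rank at most `r` is a sum of `r` rank-one matrices with orthonormal left factors,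
supported in its nonzero rows and columns. -/
theorem exists_outer_decomposition (Z : Matrix (Fin n₁) (Fin n₂) ℂ) :
    ∃ (x : Fin Z.rank → Fin n₁ → ℂ) (y : Fin Z.rank → Fin n₂ → ℂ),
      (∀ a b, star (x a) ⬝ᵥ x b = if a = b then 1 else 0) ∧ Z = ∑ a, outer (x a) (y a) ∧
      (∀ a i, (∀ k, Z i k = 0) → x a i = 0) ∧ (∀ a k, (∀ i, Z i k = 0) → y a k = 0) := by
  classical
  -- The left factors form an orthonormal basis of the column space, so they vanish on zero rows of
  -- `Z`; the right factors hold the coordinates of the columns.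
  set R := LinearMap.range (Matrix.toEuclideanLin Z) with hR
  have hrank : Module.finrank ℂ R = Z.rank := (Matrix.rank_eq_finrank_range_toLin Z
    (EuclideanSpace.basisFun (Fin n₁) ℂ).toBasis (EuclideanSpace.basisFun (Fin n₂) ℂ).toBasis).symm
  let B := (stdOrthonormalBasis ℂ R).reindex (finCongr hrank)
  let x : Fin Z.rank → Fin n₁ → ℂ := fun a => WithLp.ofLp (B a : EuclideanSpace ℂ (Fin n₁))
  have hx : ∀ a b, star (x a) ⬝ᵥ x b = if a = b then 1 else 0 := by
    intro a b
    have := orthonormal_iff_ite.1 B.orthonormal a b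
    rw [star_dotProduct_eq_inner]
    exact this
  refine ⟨x, fun a k => star (star (x a) ⬝ᵥ fun i => Z i k), hx, ?_, ?_, ?_⟩
  · ext i k
    have hmem : (WithLp.toLp 2 fun i => Z i k : EuclideanSpace ℂ (Fin n₁)) ∈ R := by
      refine ⟨WithLp.toLp 2 (Pi.single k 1), ?_⟩
      ext i
      simp [Matrix.toEuclideanLin]
    have h := congrArg (fun w : R => (w : EuclideanSpace ℂ (Fin n₁)) i) (B.sum_repr' ⟨_, hmem⟩)
    simp only [Submodule.coe_sum, Submodule.coe_smul, WithLp.ofLp_sum, Finset.sum_apply] at h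
    rw [← h, Matrix.sum_apply]
    refine Finset.sum_congr rfl fun a _ => ?_
    rw [outer_apply, star_star, star_dotProduct_eq_inner, mul_comm]
    rfl
  · intro a i hi
    obtain ⟨w, hw⟩ := (B a).2
    change (B a : EuclideanSpace ℂ (Fin n₁)) i = 0
    rw [← hw]
    simp [Matrix.toEuclideanLin, Matrix.mulVec, dotProduct, hi]
  · intro a k hk
    simp [dotProduct, hk]

theorem frobNorm_sq_eq_trace (Z : Matrix (Fin n₁) (Fin n₂) ℂ) :
    ((frobNorm Z ^ 2 : ℝ) : ℂ) = (Zᴴ * Z).trace := by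
  rw [frobNorm_sq, Matrix.trace, Finset.sum_comm]
  push_cast
  refine Finset.sum_congr rfl fun k _ => ?_
  rw [Matrix.diag_apply, Matrix.mul_apply]
  refine Finset.sum_congr rfl fun j _ => ?_
  rw [Matrix.conjTranspose_apply, ← Complex.conj_mul']
  rfl

theorem trace_outer_mul_outer (x x' : Fin n₁ → ℂ) (y y' : Fin n₂ → ℂ) :
    ((outer x y)ᴴ * outer x' y').trace = (star x ⬝ᵥ x') * (star y' ⬝ᵥ y) := by
  rw [outer_conjTranspose, outer, outer, Matrix.vecMulVec_mul_vecMulVec, Matrix.trace_vecMulVec,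
    dotProduct_smul, smul_eq_mul, dotProduct_comm y]

/-- Expand `Z` with orthonormal left factors, so that `‖Z‖²` is the sum of the `‖y a‖²`. The defects
of all pairs add up to at most `ε (∑ ‖y a‖)²`, and Cauchy–Schwarz over at most two terms costs the
factor 2. -/
theorem BilinRIP.isometry (hM : BilinRIP M k₁ k₂ ε) (hε : 0 ≤ ε) {Z : Matrix (Fin n₁) (Fin n₂) ℂ}
    (hZ : Z.rank ≤ 2) (h₁ : nonzeroRows Z ≤ k₁) (h₂ : nonzeroCols Z ≤ k₂) :
    |l2norm (sensing M Z) ^ 2 - frobNorm Z ^ 2| ≤ 2 * ε * frobNorm Z ^ 2 := by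
  classical
  obtain ⟨x, y, hx, hdec, hxr, hyc⟩ := exists_outer_decomposition Z
  have hx1 : ∀ a, l2norm (x a) = 1 := fun a => by
    have := hx a a
    rw [star_dotProduct_self, if_pos rfl] at this
    have : l2norm (x a) ^ 2 = 1 := by exact_mod_cast this
    nlinarith [l2norm_nonneg (x a)]
  have hfrob : frobNorm Z ^ 2 = ∑ a, l2norm (y a) ^ 2 := by
    apply Complex.ofReal_injective
    rw [frobNorm_sq_eq_trace]
    conv_lhs => rw [hdec]
    simp only [Matrix.conjTranspose_sum, Matrix.sum_mul, Matrix.mul_sum, Matrix.trace_sum,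
      trace_outer_mul_outer, hx, ite_mul, one_mul, zero_mul, Finset.sum_ite_eq',
      Finset.mem_univ, if_true, star_dotProduct_self]
    push_cast
    rfl
  have hA : ((l2norm (sensing M Z) ^ 2 - frobNorm Z ^ 2 : ℝ) : ℂ) = ∑ a, ∑ b,
      (star (sensing M (outer (x a) (y a))) ⬝ᵥ sensing M (outer (x b) (y b))
        - (star (x a) ⬝ᵥ x b) * (star (y b) ⬝ᵥ y a)) := by
    rw [Complex.ofReal_sub, ← star_dotProduct_self, hfrob]
    simp only [Finset.sum_sub_distrib]
    congr 1
    · conv_lhs => rw [hdec, sensing_sum]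
      rw [star_sum, sum_dotProduct]
      simp only [dotProduct_sum]
    · simp only [hx, ite_mul, one_mul, zero_mul, Finset.sum_ite_eq, Finset.mem_univ, if_true,
        star_dotProduct_self]
      push_cast
      rfl
  have hterm : ∀ a b, ‖star (sensing M (outer (x a) (y a))) ⬝ᵥ sensing M (outer (x b) (y b))
        - (star (x a) ⬝ᵥ x b) * (star (y b) ⬝ᵥ y a)‖ ≤ ε * (l2norm (y a) * l2norm (y b)) := by
    intro a b
    have hx' : ∀ c i, i ∉ Finset.univ.filter (fun j => ∃ k, Z j k ≠ 0) → x c i = 0 := by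
      intro c i hi
      exact hxr c i (by simpa using hi)
    have hy' : ∀ c i, i ∉ Finset.univ.filter (fun k => ∃ j, Z j k ≠ 0) → y c i = 0 := by
      intro c i hi
      exact hyc c i (by simpa using hi)
    rw [nonzeroRows, Set.ncard_eq_toFinset_card'] at h₁
    rw [nonzeroCols, Set.ncard_eq_toFinset_card'] at h₂
    have := hM _ _ (by simpa using h₁) (by simpa using h₂) (x a) (x b) (y a) (y b) (hx' a) (hx' b)
      (hy' a) (hy' b)
    rwa [hx1, hx1, one_mul, mul_one] at this
  rw [← Real.norm_eq_abs, ← Complex.norm_real, hA]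
  calc _ ≤ ∑ a, ∑ b, ε * (l2norm (y a) * l2norm (y b)) :=
        norm_sum_le_of_le _ fun a _ => norm_sum_le_of_le _ fun b _ => hterm a b
    _ = ε * (∑ a, l2norm (y a)) ^ 2 := by
        rw [sq, Finset.sum_mul_sum, Finset.mul_sum]
        exact Finset.sum_congr rfl fun a _ => by rw [Finset.mul_sum]
    _ ≤ ε * (2 * ∑ a, l2norm (y a) ^ 2) := by
        refine mul_le_mul_of_nonneg_left ?_ hε
        refine (sq_sum_le_card_mul_sum_sq (s := Finset.univ)).trans ?_
        rw [Finset.card_univ, Fintype.card_fin]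
        refine mul_le_mul_of_nonneg_right (by exact_mod_cast hZ) (by positivity)
    _ = _ := by rw [hfrob]; ring

theorem BilinRIP.doublySparseRIP (hM : BilinRIP M k₁ k₂ ε) (hε : 0 ≤ ε) :
    DoublySparseRIP M 2 k₁ k₂ (2 * ε) := by
  intro Z hZ h₁ h₂
  have := abs_le.1 (hM.isometry hε hZ h₁ h₂)
  constructor <;> linarith [this.1, this.2]

end RankTwo

end SparsePF

namespace SparsePF

/-! ### Squares of Gaussian variables -/

section Gaussian

/-- The second-order bound `-log (1 - y) ≤ y + y²`, which turns the exact Gaussian integral into a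
sub-exponential estimate valid for both signs. -/
theorem inv_one_sub_le_exp {y : ℝ} (h : |y| ≤ 1 / 2) : (1 - y)⁻¹ ≤ Real.exp (y + y ^ 2) := by
  obtain ⟨h1, h2⟩ := abs_le.1 h
  have hpos : 0 < 1 - y := by linarith
  rw [inv_le_iff_one_le_mul₀ hpos]
  rcases le_total 0 y with h0 | h0
  · have := Real.quadratic_le_exp_of_nonneg (x := y + y ^ 2) (by positivity)
    have h3 : (1 : ℝ) ≤ (1 + (y + y ^ 2) + (y + y ^ 2) ^ 2 / 2) * (1 - y) := by
      have : 0 ≤ 1 - y - y ^ 2 - y ^ 3 := by nlinarith [sq_nonneg y]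
      nlinarith [mul_nonneg (sq_nonneg y) this]
    exact h3.trans (mul_le_mul_of_nonneg_right this hpos.le)
  · have := Real.add_one_le_exp (y + y ^ 2)
    have h3 : (1 : ℝ) ≤ (y + y ^ 2 + 1) * (1 - y) := by
      nlinarith [pow_nonneg (neg_nonneg.2 h0) 3]
    exact h3.trans (mul_le_mul_of_nonneg_right this hpos.le)

/-- The moment generating function of the square of a centred Gaussian variable. -/
theorem exp_mul_sq_gaussianReal {v : ℝ≥0} (hv : v ≠ 0) {a : ℝ} (ha : |2 * a * v| ≤ 1 / 2) :
    Integrable (fun x => Real.exp (a * x ^ 2)) (gaussianReal 0 v) ∧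
      ∫ x, Real.exp (a * x ^ 2) ∂(gaussianReal 0 v) ≤
        Real.exp ((2 * a * v + (2 * a * v) ^ 2) / 2) := by
  have hv0 : (0 : ℝ) < v := by positivity
  have hlt : 2 * a * v < 1 := by linarith [(abs_le.1 ha).2]
  set b : ℝ := 1 / (2 * v) - a with hb
  have hb0 : 0 < b := by
    rw [hb, sub_pos, lt_div_iff₀ (by positivity)]; linarith
  have hfun : ∀ x, gaussianPDFReal 0 v x • Real.exp (a * x ^ 2)
      = (√(2 * Real.pi * v))⁻¹ * Real.exp (-b * x ^ 2) := by
    intro x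
    rw [gaussianPDFReal, smul_eq_mul, mul_assoc, ← Real.exp_add, hb]
    congr 2
    field_simp
    ring
  constructor
  · rw [gaussianReal_of_var_ne_zero _ hv,
      integrable_withDensity_iff_integrable_smul' (measurable_gaussianPDF _ _)
        (ae_of_all _ fun _ => gaussianPDF_lt_top)]
    simp only [toReal_gaussianPDF, hfun]
    exact (integrable_exp_neg_mul_sq hb0).const_mul _
  · rw [integral_gaussianReal_eq_integral_smul hv]
    simp only [hfun]
    rw [integral_const_mul, integral_gaussian, ← Real.sqrt_inv, ← Real.sqrt_mul (by positivity)]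
    have : (2 * Real.pi * v)⁻¹ * (Real.pi / b) = (1 - 2 * a * v)⁻¹ := by
      rw [hb]
      have h1 : (1 : ℝ) - 2 * a * v ≠ 0 := by linarith
      have h2 : (1 : ℝ) / (2 * v) - a = (1 - 2 * a * v) / (2 * v) := by field_simp
      rw [h2]
      field_simp
    rw [this, Real.sqrt_le_left (by positivity), ← Real.exp_nat_mul]
    refine (inv_one_sub_le_exp ha).trans (le_of_eq ?_)
    congr 1
    push_cast
    ring

theorem complexGaussian_map_re (σ2 : ℝ≥0) (c : ℂ) :
    (complexGaussian σ2).map (fun w => (star w * c).re) = gaussianReal 0 (σ2 / 2 * ‖c‖₊ ^ 2) := by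
  have hm : Measurable fun p : ℝ × ℝ => (⟨p.1, p.2⟩ : ℂ) := by
    have : (fun p : ℝ × ℝ => (⟨p.1, p.2⟩ : ℂ)) = Complex.measurableEquivRealProd.symm := by
      funext p; rfl
    rw [this]; exact Complex.measurableEquivRealProd.symm.measurable
  rw [complexGaussian, Measure.map_map (by fun_prop) hm]
  have hfun : (fun w : ℂ => (star w * c).re) ∘ (fun p : ℝ × ℝ => (⟨p.1, p.2⟩ : ℂ))
      = (fun p : ℝ × ℝ => c.re * p.1) + fun p : ℝ × ℝ => c.im * p.2 := by
    ext p; simp; ring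
  rw [hfun]
  set ν := gaussianReal 0 (σ2 / 2)
  have h1 : (ν.prod ν).map (fun p : ℝ × ℝ => c.re * p.1)
      = gaussianReal (c.re * 0) (.mk (c.re ^ 2) (sq_nonneg _) * (σ2 / 2)) := by
    rw [← gaussianReal_map_const_mul]
    have : (ν.prod ν).map Prod.fst = ν := by simp
    conv_rhs => rw [← show (ν.prod ν).map Prod.fst = gaussianReal 0 (σ2 / 2) from this]
    rw [Measure.map_map (by fun_prop) (by fun_prop)]
    rfl
  have h2 : (ν.prod ν).map (fun p : ℝ × ℝ => c.im * p.2)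
      = gaussianReal (c.im * 0) (.mk (c.im ^ 2) (sq_nonneg _) * (σ2 / 2)) := by
    rw [← gaussianReal_map_const_mul]
    have : (ν.prod ν).map Prod.snd = ν := by simp
    conv_rhs => rw [← show (ν.prod ν).map Prod.snd = gaussianReal 0 (σ2 / 2) from this]
    rw [Measure.map_map (by fun_prop) (by fun_prop)]
    rfl
  have hind : IndepFun (fun p : ℝ × ℝ => c.re * p.1) (fun p : ℝ × ℝ => c.im * p.2) (ν.prod ν) :=
    indepFun_prod (X := fun x => c.re * x) (Y := fun x => c.im * x) (by fun_prop) (by fun_prop)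
  rw [gaussianReal_add_gaussianReal_of_indepFun hind h1 h2]
  congr 1
  · simp
  · ext
    simp only [NNReal.coe_add, NNReal.coe_mul, NNReal.coe_mk, NNReal.coe_pow, coe_nnnorm,
      NNReal.coe_div, NNReal.coe_ofNat, ← Complex.normSq_eq_norm_sq, Complex.normSq_apply]
    ring

end Gaussian

/-! ### Concentration of a single measurement -/

section Concentration

variable {Ω : Type*} [MeasurableSpace Ω] {μ : Measure Ω} {m n₁ n₂ : ℕ}
  {M : Ω → Fin m → Matrix (Fin n₁) (Fin n₂) ℂ}

theorem sensing_apply (A : Fin m → Matrix (Fin n₁) (Fin n₂) ℂ) (Z : Matrix (Fin n₁) (Fin n₂) ℂ)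
    (l : Fin m) : sensing A Z l = ∑ p : Fin n₁ × Fin n₂, star (A l p.1 p.2) * Z p.1 p.2 := by
  rw [sensing, Matrix.trace, Fintype.sum_prod_type, Finset.sum_comm]
  simp [Matrix.mul_apply]

theorem IsIIDGaussian.hasLaw_re [IsProbabilityMeasure μ] (h : IsIIDGaussian μ M)
    (Z : Matrix (Fin n₁) (Fin n₂) ℂ) (hZ : frobNorm Z = 1) (l : Fin m) :
    HasLaw (fun ω => (sensing (M ω) Z l).re) (gaussianReal 0 (1 / (m : ℝ≥0) / 2)) μ := by
  have hf : ∀ p : Fin n₁ × Fin n₂, Measurable fun w : ℂ => (star w * Z p.1 p.2).re := by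
    intro p; fun_prop
  have hae : ∀ p : Fin n₁ × Fin n₂, AEMeasurable (fun ω => (star (M ω l p.1 p.2) * Z p.1 p.2).re) μ :=
    fun p => (hf p).comp_aemeasurable (h.law l p.1 p.2).aemeasurable
  have hind : iIndepFun (fun (p : Fin n₁ × Fin n₂) ω => (star (M ω l p.1 p.2) * Z p.1 p.2).re) μ := by
    have h1 := h.indep.precomp (g := fun p : Fin n₁ × Fin n₂ => (l, p)) fun p q hpq => by
      simpa using hpq
    exact h1.comp (fun (p : Fin n₁ × Fin n₂) w => (star w * Z p.1 p.2).re) hf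
  have hfun : (fun ω => (sensing (M ω) Z l).re)
      = fun ω => ∑ p : Fin n₁ × Fin n₂, (star (M ω l p.1 p.2) * Z p.1 p.2).re := by
    ext ω; rw [sensing_apply, Complex.re_sum]
  have hlaw : ∀ p : Fin n₁ × Fin n₂, μ.map (fun ω => (star (M ω l p.1 p.2) * Z p.1 p.2).re)
      = gaussianReal 0 (1 / (m : ℝ≥0) / 2 * ‖Z p.1 p.2‖₊ ^ 2) := by
    intro p
    rw [← complexGaussian_map_re, ← (h.law l p.1 p.2).map_eq,
      AEMeasurable.map_map_of_aemeasurable (hf p).aemeasurable (h.law l p.1 p.2).aemeasurable]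
    rfl
  rw [hfun]
  refine ⟨by fun_prop, ?_⟩
  have : IsProbabilityMeasure (μ.map fun ω => ∑ p : Fin n₁ × Fin n₂,
      (star (M ω l p.1 p.2) * Z p.1 p.2).re) := Measure.isProbabilityMeasure_map (by fun_prop)
  -- A sum of independent centred Gaussians is recognized by its characteristic function; the
  -- variances add up to `‖Z‖_F² / (2 m)`.
  refine Measure.ext_of_charFun ?_
  rw [hind.charFun_map_fun_sum_eq_prod hae]
  ext t
  simp only [Finset.prod_apply, hlaw, charFun_gaussianReal]
  rw [← Complex.exp_sum]
  congr 1
  have hs : ∑ p : Fin n₁ × Fin n₂, ‖Z p.1 p.2‖ ^ 2 = 1 := by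
    rw [Fintype.sum_prod_type]
    exact (frobNorm_sq Z).symm.trans (by rw [hZ, one_pow])
  have hs' : ∑ p : Fin n₁ × Fin n₂, (‖Z p.1 p.2‖ : ℂ) ^ 2 = 1 := by exact_mod_cast hs
  simp only [Finset.sum_sub_distrib]
  congr 1
  · simp
  · rw [← Finset.sum_div]
    congr 1
    rw [← Finset.sum_mul]
    congr 1
    push_cast
    rw [← Finset.mul_sum, hs', mul_one]

/-- Grouping a finite independent family into blocks gives independent blocks. -/
theorem iIndepFun_blocks {ι κ : Type*} [Finite ι] [Finite κ] {X : ι × κ → Ω → ℂ}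
    (hX : ∀ p, Measurable (X p)) (h : iIndepFun X μ) :
    iIndepFun (fun i ω (j : κ) => X (i, j) ω) μ := by
  have := h.isProbabilityMeasure
  have hprob : ∀ (i : ι) (j : κ), IsProbabilityMeasure (μ.map (X (i, j))) :=
    fun i j => Measure.isProbabilityMeasure_map (hX _).aemeasurable
  have h' : iIndepFun (fun (p : (_ : ι) × κ) ω => X (p.1, p.2) ω) μ :=
    h.precomp (Equiv.sigmaEquivProd ι κ).injective
  have hrow : ∀ i, iIndepFun (fun j ω => X (i, j) ω) μ := fun i =>
    h.precomp (g := fun j => (i, j)) fun a b hab => by simpa using hab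
  rw [iIndepFun_iff_map_fun_eq_infinitePi_map (by fun_prop)] at h' ⊢
  -- Independence means that the joint law is a product measure, and currying a product measure
  -- gives a product of products.
  have hcomp : (fun ω i j => X (i, j) ω)
      = (MeasurableEquiv.piCurry fun (_ : ι) (_ : κ) => ℂ) ∘
        (fun ω (p : (_ : ι) × κ) => X (p.1, p.2) ω) := by
    ext; simp [Sigma.curry]
  rw [hcomp, ← Measure.map_map (by fun_prop) (by fun_prop), h',
    Measure.infinitePi_map_piCurry (fun i j => μ.map (X (i, j)))]
  congr 1
  ext1 i
  rw [(iIndepFun_iff_map_fun_eq_infinitePi_map (by fun_prop)).1 (hrow i)]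

theorem IsIIDGaussian.mgf_le [IsProbabilityMeasure μ] (h : IsIIDGaussian μ M)
    (hM : ∀ l j k, Measurable fun ω => M ω l j k) (hm : 0 < m)
    (Z : Matrix (Fin n₁) (Fin n₂) ℂ) (hZ : frobNorm Z = 1) {x : ℝ} (hx : |x| ≤ 1 / 4) :
    Integrable (fun ω => Real.exp (m * x * l2norm (sensing (M ω) Z) ^ 2)) μ ∧
      mgf (fun ω => l2norm (sensing (M ω) Z) ^ 2) μ (m * x) ≤ Real.exp (m * (x + 2 * x ^ 2)) := by
  have hm' : (0 : ℝ) < m := by exact_mod_cast hm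
  have hZ' : frobNorm ((-Complex.I) • Z) = 1 := by rw [frobNorm_smul, hZ]; simp
  have hmeas : ∀ l, Measurable fun ω => sensing (M ω) Z l := by
    intro l
    simp only [sensing_apply]
    fun_prop
  let v : ℝ≥0 := 1 / (m : ℝ≥0) / 2
  have hv : v ≠ 0 := by positivity
  have hvm : 2 * (2 * (m * x)) * (v : ℝ) = 2 * x := by
    simp only [v, NNReal.coe_div, NNReal.coe_one, NNReal.coe_natCast, NNReal.coe_ofNat]
    field_simp
  have hgauss := exp_mul_sq_gaussianReal hv (a := 2 * (m * x))
    (by rw [hvm, abs_mul, abs_two]; linarith)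
  rw [hvm] at hgauss
  have hre := fun l => h.hasLaw_re Z hZ l
  -- The imaginary part of `𝒜(Z)` is the real part of `𝒜(-i Z)`.
  have him : ∀ l, HasLaw (fun ω => (sensing (M ω) Z l).im) (gaussianReal 0 v) μ := by
    intro l
    have := h.hasLaw_re _ hZ' l
    simp only [sensing_smul, Pi.smul_apply, smul_eq_mul] at this
    simpa only [Complex.mul_re, Complex.neg_re, Complex.neg_im, Complex.I_re, Complex.I_im, neg_zero,
      zero_mul, zero_sub, neg_mul, neg_neg, one_mul] using this
  have hbound : ∀ {G : Ω → ℝ}, HasLaw G (gaussianReal 0 v) μ →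
      Integrable (fun ω => Real.exp (2 * (m * x) * G ω ^ 2)) μ ∧
      ∫ ω, Real.exp (2 * (m * x) * G ω ^ 2) ∂μ ≤ Real.exp (x + 2 * x ^ 2) := by
    intro G hG
    have hint := hgauss.1
    rw [← hG.map_eq] at hint
    refine ⟨hint.comp_aemeasurable hG.aemeasurable, ?_⟩
    have := integral_map hG.aemeasurable hint.aestronglyMeasurable
    rw [← this, hG.map_eq]
    refine hgauss.2.trans (le_of_eq ?_)
    congr 1; ring
  -- The arithmetic–geometric mean inequality separates real and imaginary parts, so their joint law
  -- is not needed. It doubles the exponent, whence the range `|x| ≤ 1/4`.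
  have hpt : ∀ (w : ℂ), Real.exp (m * x * ‖w‖ ^ 2)
      ≤ 1 / 2 * (Real.exp (2 * (m * x) * w.re ^ 2) + Real.exp (2 * (m * x) * w.im ^ 2)) := by
    intro w
    rw [← Complex.normSq_eq_norm_sq, Complex.normSq_apply]
    have h1 := two_mul_le_add_sq (Real.exp (m * x * w.re ^ 2)) (Real.exp (m * x * w.im ^ 2))
    rw [← Real.exp_nat_mul, ← Real.exp_nat_mul, mul_assoc, ← Real.exp_add] at h1
    have e1 : m * x * (w.re * w.re + w.im * w.im) = m * x * w.re ^ 2 + m * x * w.im ^ 2 := by ring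
    have e2 : ∀ a : ℝ, ((2 : ℕ) : ℝ) * (m * x * a) = 2 * (m * x) * a := by intro a; push_cast; ring
    rw [e2, e2] at h1
    rw [e1]
    linarith
  have hint : ∀ l, Integrable (fun ω => Real.exp (m * x * ‖sensing (M ω) Z l‖ ^ 2)) μ := by
    intro l
    refine Integrable.mono' (((hbound (hre l)).1.add (hbound (him l)).1).const_mul (1 / 2))
      ?_ (ae_of_all _ fun ω => ?_)
    · have := hmeas l; exact Measurable.aestronglyMeasurable (by fun_prop)
    · rw [Real.norm_of_nonneg (Real.exp_pos _).le]; exact hpt _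
  have hone : ∀ l, mgf (fun ω => ‖sensing (M ω) Z l‖ ^ 2) μ (m * x) ≤ Real.exp (x + 2 * x ^ 2) := by
    intro l
    calc mgf (fun ω => ‖sensing (M ω) Z l‖ ^ 2) μ (m * x)
        ≤ ∫ ω, 1 / 2 * (Real.exp (2 * (m * x) * (sensing (M ω) Z l).re ^ 2)
            + Real.exp (2 * (m * x) * (sensing (M ω) Z l).im ^ 2)) ∂μ :=
          integral_mono (hint l) (((hbound (hre l)).1.add (hbound (him l)).1).const_mul (1 / 2))
            fun ω => hpt _
      _ ≤ _ := by
          rw [integral_const_mul, integral_add (hbound (hre l)).1 (hbound (him l)).1]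
          linarith [(hbound (hre l)).2, (hbound (him l)).2]
  have hindep : iIndepFun (fun l ω => ‖sensing (M ω) Z l‖ ^ 2) μ := by
    have h1 := iIndepFun_blocks (X := fun (p : Fin m × Fin n₁ × Fin n₂) ω => M ω p.1 p.2.1 p.2.2)
      (fun p => hM _ _ _) h.indep
    have h2 := h1.comp (fun _ (B : Fin n₁ × Fin n₂ → ℂ) =>
      ‖∑ p : Fin n₁ × Fin n₂, star (B p) * Z p.1 p.2‖ ^ 2) (fun _ => by fun_prop)
    convert! h2 using 3
    rw [sensing_apply]
    rfl
  have hsum : (fun ω => l2norm (sensing (M ω) Z) ^ 2)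
      = ∑ l, fun ω => ‖sensing (M ω) Z l‖ ^ 2 := by
    ext ω; rw [l2norm_sq]; simp
  have hmeas' : ∀ l, Measurable fun ω => ‖sensing (M ω) Z l‖ ^ 2 := fun l => by
    have := hmeas l; fun_prop
  constructor
  · have := hindep.integrable_exp_mul_sum hmeas' (s := Finset.univ) (t := m * x) fun l _ => hint l
    rw [← hsum] at this
    exact this
  · rw [hsum, hindep.mgf_sum hmeas']
    calc _ ≤ ∏ _l : Fin m, Real.exp (x + 2 * x ^ 2) :=
          Finset.prod_le_prod (fun _ _ => mgf_nonneg) fun l _ => hone l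
      _ = _ := by rw [Finset.prod_const, Finset.card_univ, Fintype.card_fin, ← Real.exp_nat_mul]

/-- Chernoff's bound at `x = ± t / 4`, the optimal choice in `2 x² - t |x|`, gives `m t² / 8` for
both tails. The strict inequality makes the event empty when `Z = 0`. -/
theorem IsIIDGaussian.concentration [IsProbabilityMeasure μ] (h : IsIIDGaussian μ M)
    (hM : ∀ l j k, Measurable fun ω => M ω l j k) (hm : 0 < m)
    (Z : Matrix (Fin n₁) (Fin n₂) ℂ) {t : ℝ} (ht : 0 ≤ t) (ht' : t ≤ 1) :
    μ.real {ω | t * frobNorm Z ^ 2 < |l2norm (sensing (M ω) Z) ^ 2 - frobNorm Z ^ 2|} ≤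
      2 * Real.exp (-(m * t ^ 2 / 8)) := by
  rcases (frobNorm_nonneg Z).eq_or_lt with h0 | h0
  · have hZ : Z = 0 := by
      have h1 := frobNorm_sq Z
      rw [← h0, zero_pow two_ne_zero] at h1
      ext j k
      have h2 := (Finset.sum_eq_zero_iff_of_nonneg fun j _ => by positivity).1 h1.symm j
        (Finset.mem_univ _)
      have h3 := (Finset.sum_eq_zero_iff_of_nonneg fun k _ => by positivity).1 h2 k
        (Finset.mem_univ _)
      simpa using h3
    have : ∀ ω, sensing (M ω) Z = 0 := fun ω => by rw [hZ]; ext l; simp [sensing]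
    simp only [this, ← h0]
    simp
    positivity
  set W : Matrix (Fin n₁) (Fin n₂) ℂ := ((frobNorm Z : ℂ)⁻¹) • Z with hW
  have hW1 : frobNorm W = 1 := by
    rw [hW, frobNorm_smul, norm_inv, Complex.norm_real, Real.norm_of_nonneg h0.le,
      inv_mul_cancel₀ h0.ne']
  have hscale : ∀ ω, l2norm (sensing (M ω) Z) ^ 2
      = frobNorm Z ^ 2 * l2norm (sensing (M ω) W) ^ 2 := by
    intro ω
    rw [hW, sensing_smul, l2norm_smul, norm_inv, Complex.norm_real, Real.norm_of_nonneg h0.le]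
    field_simp
  have hsub : {ω | t * frobNorm Z ^ 2 < |l2norm (sensing (M ω) Z) ^ 2 - frobNorm Z ^ 2|} ⊆
      {ω | 1 + t ≤ l2norm (sensing (M ω) W) ^ 2} ∪ {ω | l2norm (sensing (M ω) W) ^ 2 ≤ 1 - t} := by
    intro ω hω
    simp only [Set.mem_ofPred_eq, hscale] at hω
    have hp : 0 < frobNorm Z ^ 2 := by positivity
    rw [← mul_sub_one, abs_mul, abs_of_pos hp, mul_comm t] at hω
    have h1 := lt_of_mul_lt_mul_left hω hp.le
    rcases lt_abs.1 h1 with h2 | h2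
    · left; simp only [Set.mem_ofPred_eq]; linarith
    · right; simp only [Set.mem_ofPred_eq]; linarith
  have hup : μ.real {ω | 1 + t ≤ l2norm (sensing (M ω) W) ^ 2} ≤ Real.exp (-(m * t ^ 2 / 8)) := by
    obtain ⟨h1, h2⟩ := h.mgf_le hM hm W hW1 (x := t / 4) (by rw [abs_of_nonneg] <;> linarith)
    refine (measure_ge_le_exp_mul_mgf (1 + t) (by positivity) h1).trans ?_
    refine (mul_le_mul_of_nonneg_left h2 (Real.exp_pos _).le).trans (le_of_eq ?_)
    rw [← Real.exp_add]
    congr 1; ring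
  have hlo : μ.real {ω | l2norm (sensing (M ω) W) ^ 2 ≤ 1 - t} ≤ Real.exp (-(m * t ^ 2 / 8)) := by
    obtain ⟨h1, h2⟩ := h.mgf_le hM hm W hW1 (x := -(t / 4))
      (by rw [abs_neg, abs_of_nonneg] <;> linarith)
    have hneg : (m : ℝ) * -(t / 4) ≤ 0 := by
      have : (0 : ℝ) ≤ m * (t / 4) := by positivity
      linarith
    refine (measure_le_le_exp_mul_mgf (1 - t) hneg h1).trans ?_
    refine (mul_le_mul_of_nonneg_left h2 (Real.exp_pos _).le).trans (le_of_eq ?_)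
    rw [← Real.exp_add]
    congr 1; ring
  calc _ ≤ _ := measureReal_mono hsub
    _ ≤ _ := measureReal_union_le _ _
    _ ≤ _ := by linarith

end Concentration

end SparsePF

namespace SparsePF

/-! ### Nets -/

section Nets

/-- The unit ball of a finite-dimensional real normed space has a `1/2`-net of at most `5 ^ dim`
points. -/
theorem exists_half_net (E : Type*) [NormedAddCommGroup E] [NormedSpace ℝ E]
    [FiniteDimensional ℝ E] :
    ∃ N : Finset E, N.card ≤ 5 ^ Module.finrank ℝ E ∧ (∀ c ∈ N, ‖c‖ ≤ 1) ∧
      ∀ x : E, ‖x‖ ≤ 1 → ∃ c ∈ N, ‖x - c‖ ≤ 1 / 2 := by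
  classical
  -- A 1-separated subset of the ball of radius 2 of greatest cardinality is a 1-net of that ball;
  -- halving it gives the net of the unit ball. The volume bound `5 ^ dim` ensures that a greatest
  -- cardinality exists.
  let P : ℕ → Prop := fun k => ∃ s : Finset E, s.card = k ∧ (∀ c ∈ s, ‖c‖ ≤ 2) ∧
    ∀ c ∈ s, ∀ d ∈ s, c ≠ d → 1 ≤ ‖c - d‖
  have hbd : ∀ k, P k → k ≤ 5 ^ Module.finrank ℝ E := by
    rintro k ⟨s, rfl, h1, h2⟩
    exact Besicovitch.card_le_of_separated s h1 h2
  have hP0 : P 0 := ⟨∅, by simp⟩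
  obtain ⟨s, hs, h1, h2⟩ : P (Nat.findGreatest P (5 ^ Module.finrank ℝ E)) :=
    Nat.findGreatest_spec (Nat.zero_le _) hP0
  have hmax : ∀ y : E, ‖y‖ ≤ 2 → ∃ c ∈ s, ‖y - c‖ < 1 := by
    intro y hy
    by_contra! hcon
    have hys : y ∉ s := fun h => by have := hcon y h; simp at this; linarith
    have hP : P (s.card + 1) := by
      refine ⟨insert y s, Finset.card_insert_of_notMem hys, ?_, ?_⟩
      · intro c hc
        rcases Finset.mem_insert.1 hc with rfl | hc
        · exact hy
        · exact h1 c hc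
      · intro c hc d hd hcd
        rcases Finset.mem_insert.1 hc with rfl | hc' <;> rcases Finset.mem_insert.1 hd with rfl | hd'
        · exact absurd rfl hcd
        · exact hcon d hd'
        · rw [norm_sub_rev]; exact hcon c hc'
        · exact h2 c hc' d hd' hcd
    have := Nat.le_findGreatest (hbd _ hP) hP
    omega
  refine ⟨s.image fun c => (1 / 2 : ℝ) • c,
    Finset.card_image_le.trans (Besicovitch.card_le_of_separated s h1 h2), ?_, ?_⟩
  · intro c hc
    obtain ⟨d, hd, rfl⟩ := Finset.mem_image.1 hc
    rw [norm_smul, Real.norm_of_nonneg (by norm_num)]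
    linarith [h1 d hd]
  · intro x hx
    obtain ⟨c, hc, hxc⟩ := hmax ((2 : ℝ) • x) (by
      rw [norm_smul, Real.norm_of_nonneg (by norm_num)]; linarith)
    refine ⟨_, Finset.mem_image_of_mem _ hc, ?_⟩
    have : x - (1 / 2 : ℝ) • c = (1 / 2 : ℝ) • ((2 : ℝ) • x - c) := by
      rw [smul_sub, smul_smul]; norm_num
    rw [this, norm_smul, Real.norm_of_nonneg (by norm_num)]
    linarith

/-- A linear functional is controlled by its values on a `1/2`-net of the unit ball. -/
theorem norm_le_of_half_net {E : Type*} [NormedAddCommGroup E] [NormedSpace ℝ E]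
    [FiniteDimensional ℝ E] {N : Finset E} (hN : ∀ x : E, ‖x‖ ≤ 1 → ∃ c ∈ N, ‖x - c‖ ≤ 1 / 2)
    (L : E →ₗ[ℝ] ℂ) {B : ℝ} (hB : ∀ c ∈ N, ‖L c‖ ≤ B) (x : E) : ‖L x‖ ≤ 2 * B * ‖x‖ := by
  set F := LinearMap.toContinuousLinearMap L with hF
  have hB0 : 0 ≤ B := by
    obtain ⟨c, hc, -⟩ := hN 0 (by simp)
    exact (norm_nonneg _).trans (hB c hc)
  -- Approximation on the net bounds `‖F‖` by `B` plus half of itself, which is absorbed because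
  -- `‖F‖` is finite.
  have h1 : ‖F‖ ≤ B + ‖F‖ / 2 := by
    refine ContinuousLinearMap.opNorm_le_of_unit_norm (by positivity) fun y hy => ?_
    obtain ⟨c, hc, hyc⟩ := hN y hy.le
    calc ‖F y‖ = ‖F c + F (y - c)‖ := by rw [← map_add]; congr 2; abel
      _ ≤ ‖F c‖ + ‖F (y - c)‖ := norm_add_le _ _
      _ ≤ B + ‖F‖ * (1 / 2) := add_le_add (hB c hc)
          ((F.le_opNorm _).trans (mul_le_mul_of_nonneg_left hyc (norm_nonneg _)))
      _ = _ := by ring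
  exact (F.le_opNorm x).trans (mul_le_mul_of_nonneg_right (by linarith) (norm_nonneg _))

/-- A finite set of vectors supported in `I` that controls real-linear functionals on all
vectors supported in `I`. -/
theorem exists_support_net {n : ℕ} (I : Finset (Fin n)) :
    ∃ N : Finset (Fin n → ℂ), N.card ≤ 25 ^ I.card ∧
      (∀ c ∈ N, l2norm c ≤ 1) ∧
      ∀ f : (Fin n → ℂ) → ℂ, (∀ x y, f (x + y) = f x + f y) →
        (∀ (r : ℝ) (x), f ((r : ℂ) • x) = r * f x) →
        ∀ B : ℝ, (∀ c ∈ N, ‖f c‖ ≤ B) →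
          ∀ x : Fin n → ℂ, (∀ i, i ∉ I → x i = 0) → ‖f x‖ ≤ 2 * B * l2norm x := by
  classical
  let E := EuclideanSpace ℂ I
  -- The functionals of interest are linear in some arguments and conjugate-linear in others, so the
  -- net is taken over the reals: `5 ^ (2 |I|) = 25 ^ |I|`.
  have hfin : Module.finrank ℝ E = 2 * I.card := by
    rw [(WithLp.linearEquiv 2 ℝ (I → ℂ)).finrank_eq, Module.finrank_pi_fintype]
    simp [Complex.finrank_real_complex, mul_comm]
  obtain ⟨N, hN, hN1, hnet⟩ := exists_half_net E
  let ext : E → Fin n → ℂ := fun w i => if h : i ∈ I then w ⟨i, h⟩ else 0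
  have hext : ∀ w, l2norm (ext w) = ‖w‖ := by
    intro w
    rw [← sq_eq_sq₀ (l2norm_nonneg _) (norm_nonneg _), l2norm_sq, EuclideanSpace.norm_sq_eq,
      ← Finset.sum_subset (Finset.subset_univ I), ← Finset.sum_coe_sort I]
    · exact Finset.sum_congr rfl fun i _ => by simp [ext]
    · intro i _ hi; simp [ext, hi]
  refine ⟨N.image ext, Finset.card_image_le.trans (hN.trans (le_of_eq ?_)), ?_, ?_⟩
  · rw [hfin, pow_mul]; norm_num
  · intro c hc
    obtain ⟨w, hw, rfl⟩ := Finset.mem_image.1 hc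
    rw [hext]; exact hN1 w hw
  · intro f hadd hsmul B hB x hx
    let L : E →ₗ[ℝ] ℂ :=
      { toFun := fun w => f (ext w)
        map_add' := fun w w' => by
          rw [← hadd]; congr 1; ext i; by_cases hi : i ∈ I
          · simp only [ext, hi, Pi.add_apply, dif_pos]; rfl
          · simp [ext, hi]
        map_smul' := fun r w => by
          rw [RingHom.id_apply, Complex.real_smul, ← hsmul]
          congr 1; ext i; by_cases hi : i ∈ I
          · simp only [ext, hi, Pi.smul_apply, dif_pos, smul_eq_mul, ← Complex.real_smul]; rfl
          · simp [ext, hi] }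
    have hx' : ext (WithLp.toLp 2 fun i : I => x i) = x := by
      ext i; by_cases hi : i ∈ I <;> simp [ext, hi, hx]
    have := norm_le_of_half_net hnet L (B := B) (fun c hc => hB _ (Finset.mem_image_of_mem _ hc))
      (WithLp.toLp 2 fun i : I => x i)
    rw [← hext, hx'] at this
    change ‖f (ext (WithLp.toLp 2 fun i : I => x i))‖ ≤ _ at this
    rwa [hx'] at this

end Nets

/-! ### From concentration to near isometry -/

section Union

variable {m n₁ n₂ : ℕ}

/-- The defect of the inner product of two rank-one matrices under the measurement operator. -/
noncomputable def bilinDefect (M : Fin m → Matrix (Fin n₁) (Fin n₂) ℂ) (x : Fin n₁ → ℂ)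
    (y : Fin n₂ → ℂ) (x' : Fin n₁ → ℂ) (y' : Fin n₂ → ℂ) : ℂ :=
  star (sensing M (outer x y)) ⬝ᵥ sensing M (outer x' y') - (star x ⬝ᵥ x') * (star y' ⬝ᵥ y)

theorem l2norm_add_smul_sq {n : ℕ} (a b : Fin n → ℂ) {c : ℂ} (hc : ‖c‖ = 1) :
    l2norm (a + c • b) ^ 2 = l2norm a ^ 2 + l2norm b ^ 2 + 2 * (c * (star a ⬝ᵥ b)).re := by
  have h : star b ⬝ᵥ a = star (star a ⬝ᵥ b) := by rw [star_star_dotProduct]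
  have hcc : star c * c = 1 := by
    rw [Complex.star_def, Complex.conj_mul', hc]; simp
  apply Complex.ofReal_injective
  rw [← star_dotProduct_self]
  simp only [star_add, star_smul, add_dotProduct, dotProduct_add, smul_dotProduct, dotProduct_smul,
    smul_eq_mul, star_dotProduct_self, h]
  have hre := Complex.add_conj (c * (star a ⬝ᵥ b))
  rw [map_mul] at hre
  push_cast at hre ⊢
  rw [← hre, Complex.star_def]
  rw [Complex.star_def] at hcc
  linear_combination ((l2norm b : ℂ) ^ 2) * hcc

theorem frobNorm_outer_add_smul_sq (x x' : Fin n₁ → ℂ) (y y' : Fin n₂ → ℂ) {c : ℂ} (hc : ‖c‖ = 1) :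
    frobNorm (outer x y + c • outer x' y') ^ 2 = frobNorm (outer x y) ^ 2
      + frobNorm (outer x' y') ^ 2 + 2 * (c * ((star x ⬝ᵥ x') * (star y' ⬝ᵥ y))).re := by
  have hcc : star c * c = 1 := by
    rw [Complex.star_def, Complex.conj_mul', hc]; simp
  apply Complex.ofReal_injective
  have hre := Complex.add_conj (c * ((star x ⬝ᵥ x') * (star y' ⬝ᵥ y)))
  have h1 : (starRingEnd ℂ) (star x ⬝ᵥ x') = star x' ⬝ᵥ x := star_star_dotProduct x x'
  have h2 : (starRingEnd ℂ) (star y' ⬝ᵥ y) = star y ⬝ᵥ y' := star_star_dotProduct y' y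
  rw [map_mul, map_mul, h1, h2] at hre
  rw [Complex.ofReal_add, Complex.ofReal_add, frobNorm_sq_eq_trace, frobNorm_sq_eq_trace,
    frobNorm_sq_eq_trace]
  simp only [Matrix.conjTranspose_add, Matrix.conjTranspose_smul, Matrix.add_mul, Matrix.mul_add,
    Matrix.trace_add, Matrix.smul_mul, Matrix.mul_smul, Matrix.trace_smul, trace_outer_mul_outer,
    smul_eq_mul]
  push_cast at hre ⊢
  rw [← hre, Complex.star_def]
  rw [Complex.star_def] at hcc
  linear_combination ((star x' ⬝ᵥ x') * (star y' ⬝ᵥ y')) * hcc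

/-- The four units used for polarization. -/
noncomputable def phases : Finset ℂ := {1, -1, Complex.I, -Complex.I}

theorem norm_of_mem_phases {c : ℂ} (hc : c ∈ phases) : ‖c‖ = 1 := by
  simp only [phases, Finset.mem_insert, Finset.mem_singleton] at hc
  rcases hc with rfl | rfl | rfl | rfl <;> simp

theorem card_phases_le : phases.card ≤ 4 := Finset.card_le_four

/-- Polarization. The defect of the squared norm at phase `c` is `D + 2 Re (c Q)` with `D`
independent of `c`, so opposite phases cancel `D` and bound the real and imaginary parts of `Q` by
`2 t` each. The factor 4 in `key` is the square of the norm bound 2 for the combined matrix. -/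
theorem norm_bilinDefect_le_of_phases {M : Fin m → Matrix (Fin n₁) (Fin n₂) ℂ} {t : ℝ} (ht : 0 ≤ t)
    {x x' : Fin n₁ → ℂ} {y y' : Fin n₂ → ℂ} (hx : l2norm x ≤ 1) (hx' : l2norm x' ≤ 1)
    (hy : l2norm y ≤ 1) (hy' : l2norm y' ≤ 1)
    (h : ∀ c ∈ phases, |l2norm (sensing M (outer x y + c • outer x' y')) ^ 2
      - frobNorm (outer x y + c • outer x' y') ^ 2| ≤ t * frobNorm (outer x y + c • outer x' y') ^ 2) :
    ‖bilinDefect M x y x' y'‖ ≤ 4 * t := by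
  set Q := bilinDefect M x y x' y' with hQ
  set D : ℝ := l2norm (sensing M (outer x y)) ^ 2 + l2norm (sensing M (outer x' y')) ^ 2
    - frobNorm (outer x y) ^ 2 - frobNorm (outer x' y') ^ 2 with hD
  have ho : frobNorm (outer x y) ≤ 1 := by
    rw [frobNorm_outer]; exact mul_le_one₀ hx (l2norm_nonneg _) hy
  have ho' : frobNorm (outer x' y') ≤ 1 := by
    rw [frobNorm_outer]; exact mul_le_one₀ hx' (l2norm_nonneg _) hy'
  have key : ∀ c ∈ phases, |D + 2 * (c * Q).re| ≤ 4 * t := by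
    intro c hc
    have hc1 := norm_of_mem_phases hc
    have h1 := h c hc
    have h2 : frobNorm (outer x y + c • outer x' y') ≤ 2 := by
      have := frobNorm_sub_le (outer x y) ((-c) • outer x' y')
      rw [frobNorm_smul, norm_neg, hc1, neg_smul, sub_neg_eq_add] at this
      linarith
    have h3 : frobNorm (outer x y + c • outer x' y') ^ 2 ≤ 2 ^ 2 :=
      pow_le_pow_left₀ (frobNorm_nonneg _) h2 2
    have h4 : t * frobNorm (outer x y + c • outer x' y') ^ 2 ≤ t * 2 ^ 2 :=
      mul_le_mul_of_nonneg_left h3 ht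
    have h5 : l2norm (sensing M (outer x y + c • outer x' y')) ^ 2
        - frobNorm (outer x y + c • outer x' y') ^ 2 = D + 2 * (c * Q).re := by
      rw [sensing_add, sensing_smul, l2norm_add_smul_sq _ _ hc1, frobNorm_outer_add_smul_sq _ _ _ _ hc1,
        hQ, bilinDefect, mul_sub, Complex.sub_re, hD]
      ring
    rw [h5] at h1
    linarith
  have hm1 := abs_le.1 (key 1 (by simp [phases]))
  have hm2 := abs_le.1 (key (-1) (by simp [phases]))
  have hm3 := abs_le.1 (key Complex.I (by simp [phases]))
  have hm4 := abs_le.1 (key (-Complex.I) (by simp [phases]))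
  simp only [one_mul, neg_mul, Complex.neg_re, Complex.I_mul_re] at hm1 hm2 hm3 hm4
  have hre : |Q.re| ≤ 2 * t := abs_le.2 ⟨by linarith, by linarith⟩
  have him : |Q.im| ≤ 2 * t := abs_le.2 ⟨by linarith, by linarith⟩
  linarith [Complex.norm_le_abs_re_add_abs_im Q]

variable {Ω : Type*} [MeasurableSpace Ω] {μ : Measure Ω}

theorem measureReal_biUnion_le_card_mul {ι : Type*} (s : Finset ι) (f : ι → Set Ω) {k : ℕ} {b : ℝ}
    (hk : s.card ≤ k) (hb : 0 ≤ b) (h : ∀ i ∈ s, μ.real (f i) ≤ b) :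
    μ.real (⋃ i ∈ s, f i) ≤ k * b :=
  calc _ ≤ ∑ i ∈ s, μ.real (f i) := measureReal_biUnion_finset_le _ _
    _ ≤ ∑ _i ∈ s, b := Finset.sum_le_sum h
    _ = s.card * b := by rw [Finset.sum_const, nsmul_eq_mul]
    _ ≤ _ := mul_le_mul_of_nonneg_right (by exact_mod_cast hk) hb

variable [IsProbabilityMeasure μ] {M : Ω → Fin m → Matrix (Fin n₁) (Fin n₂) ℂ}

/-- The defect is real-linear in each of its four arguments, so it suffices to control it on nets of
the factors and to free one argument at a time. Each release costs a factor 2, which gives `2⁴ · 4 t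
= 64 t`; the 8 is four phases times two tails. -/
theorem IsIIDGaussian.measure_defect_support (h : IsIIDGaussian μ M)
    (hM : ∀ l j k, Measurable fun ω => M ω l j k) (hm : 0 < m) {t : ℝ} (ht : 0 ≤ t) (ht' : t ≤ 1)
    (I : Finset (Fin n₁)) (K : Finset (Fin n₂)) :
    μ.real {ω | ∃ (x x' : Fin n₁ → ℂ) (y y' : Fin n₂ → ℂ), (∀ i, i ∉ I → x i = 0) ∧
        (∀ i, i ∉ I → x' i = 0) ∧ (∀ i, i ∉ K → y i = 0) ∧ (∀ i, i ∉ K → y' i = 0) ∧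
        64 * t * (l2norm x * l2norm y * l2norm x' * l2norm y') < ‖bilinDefect (M ω) x y x' y'‖} ≤
      8 * 25 ^ (2 * (I.card + K.card)) * Real.exp (-(m * t ^ 2 / 8)) := by
  classical
  obtain ⟨N₁, hN₁, hN₁1, hnet₁⟩ := exists_support_net I
  obtain ⟨N₂, hN₂, hN₂1, hnet₂⟩ := exists_support_net K
  set bad : (Fin n₁ → ℂ) → (Fin n₂ → ℂ) → (Fin n₁ → ℂ) → (Fin n₂ → ℂ) → ℂ → Set Ω :=
    fun x y x' y' c => {ω | t * frobNorm (outer x y + c • outer x' y') ^ 2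
      < |l2norm (sensing (M ω) (outer x y + c • outer x' y')) ^ 2
        - frobNorm (outer x y + c • outer x' y') ^ 2|} with hbad
  have hsub : {ω | ∃ (x x' : Fin n₁ → ℂ) (y y' : Fin n₂ → ℂ), (∀ i, i ∉ I → x i = 0) ∧
        (∀ i, i ∉ I → x' i = 0) ∧ (∀ i, i ∉ K → y i = 0) ∧ (∀ i, i ∉ K → y' i = 0) ∧
        64 * t * (l2norm x * l2norm y * l2norm x' * l2norm y') < ‖bilinDefect (M ω) x y x' y'‖} ⊆
      ⋃ x ∈ N₁, ⋃ y ∈ N₂, ⋃ x' ∈ N₁, ⋃ y' ∈ N₂, ⋃ c ∈ phases, bad x y x' y' c := by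
    rintro ω ⟨x, x', y, y', hx, hx', hy, hy', hlt⟩
    by_contra hω
    simp only [Set.mem_iUnion, not_exists, hbad, Set.mem_ofPred_eq, not_lt] at hω
    refine absurd hlt (not_lt.2 ?_)
    have h0 : ∀ a ∈ N₁, ∀ b ∈ N₂, ∀ a' ∈ N₁, ∀ b' ∈ N₂,
        ‖bilinDefect (M ω) a b a' b'‖ ≤ 4 * t := fun a ha b hb a' ha' b' hb' =>
      norm_bilinDefect_le_of_phases ht (hN₁1 a ha) (hN₁1 a' ha') (hN₂1 b hb) (hN₂1 b' hb')
        (hω a ha b hb a' ha' b' hb')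
    have h1 : ∀ a ∈ N₁, ∀ b ∈ N₂, ∀ a' ∈ N₁,
        ‖bilinDefect (M ω) a b a' y'‖ ≤ 2 * (4 * t) * l2norm y' := fun a ha b hb a' ha' =>
      hnet₂ (fun w => bilinDefect (M ω) a b a' w)
        (fun w w' => by
          simp only [bilinDefect, outer_add_right, sensing_add, dotProduct_add, star_add,
            add_dotProduct]
          ring)
        (fun r w => by
          simp only [bilinDefect, outer_smul_right, sensing_smul, dotProduct_smul, star_smul,
            smul_dotProduct, smul_eq_mul, Complex.star_def, Complex.conj_ofReal]
          ring) _ (h0 a ha b hb a' ha') y' hy'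
    have h2 : ∀ a ∈ N₁, ∀ b ∈ N₂,
        ‖bilinDefect (M ω) a b x' y'‖ ≤ 2 * (2 * (4 * t) * l2norm y') * l2norm x' :=
      fun a ha b hb => hnet₁ (fun w => bilinDefect (M ω) a b w y')
        (fun w w' => by
          simp only [bilinDefect, outer_add_left, sensing_add, dotProduct_add]
          ring)
        (fun r w => by
          simp only [bilinDefect, outer_smul_left, sensing_smul, dotProduct_smul, smul_eq_mul]
          ring) _ (h1 a ha b hb) x' hx'
    have h3 : ∀ a ∈ N₁, ‖bilinDefect (M ω) a y x' y'‖
        ≤ 2 * (2 * (2 * (4 * t) * l2norm y') * l2norm x') * l2norm y :=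
      fun a ha => hnet₂ (fun w => bilinDefect (M ω) a w x' y')
        (fun w w' => by
          simp only [bilinDefect, outer_add_right, sensing_add, dotProduct_add, star_add,
            add_dotProduct]
          ring)
        (fun r w => by
          simp only [bilinDefect, outer_smul_right, sensing_smul, dotProduct_smul, star_smul,
            smul_dotProduct, smul_eq_mul, Complex.star_def, Complex.conj_ofReal]
          ring) _ (h2 a ha) y hy
    have h4 : ‖bilinDefect (M ω) x y x' y'‖
        ≤ 2 * (2 * (2 * (2 * (4 * t) * l2norm y') * l2norm x') * l2norm y) * l2norm x :=
      hnet₁ (fun w => bilinDefect (M ω) w y x' y')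
        (fun w w' => by
          simp only [bilinDefect, outer_add_left, sensing_add, star_add, add_dotProduct]
          ring)
        (fun r w => by
          simp only [bilinDefect, outer_smul_left, sensing_smul, star_smul,
            smul_dotProduct, smul_eq_mul, Complex.star_def, Complex.conj_ofReal]
          ring) _ h3 x hx
    refine h4.trans (le_of_eq ?_)
    ring
  have hcard : μ.real (⋃ x ∈ N₁, ⋃ y ∈ N₂, ⋃ x' ∈ N₁, ⋃ y' ∈ N₂, ⋃ c ∈ phases, bad x y x' y' c) ≤
      (25 ^ I.card : ℕ) * ((25 ^ K.card : ℕ) * ((25 ^ I.card : ℕ) * ((25 ^ K.card : ℕ) *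
        ((4 : ℕ) * (2 * Real.exp (-(m * t ^ 2 / 8))))))) :=
    measureReal_biUnion_le_card_mul _ _ hN₁ (by positivity) fun x _ =>
    measureReal_biUnion_le_card_mul _ _ hN₂ (by positivity) fun y _ =>
    measureReal_biUnion_le_card_mul _ _ hN₁ (by positivity) fun x' _ =>
    measureReal_biUnion_le_card_mul _ _ hN₂ (by positivity) fun y' _ =>
    measureReal_biUnion_le_card_mul _ _ card_phases_le (by positivity) fun c _ =>
      h.concentration hM hm _ ht ht'
  refine (measureReal_mono hsub (measure_ne_top μ _)).trans (hcard.trans (le_of_eq ?_))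
  push_cast
  ring

/-- Union bound over supports. Supports are enlarged to size exactly `min k n`, as `k = 3 s` may
exceed the dimension. -/
theorem IsIIDGaussian.measure_not_bilinRIP (h : IsIIDGaussian μ M)
    (hM : ∀ l j k, Measurable fun ω => M ω l j k) (hm : 0 < m) {t : ℝ} (ht : 0 ≤ t) (ht' : t ≤ 1)
    (k₁ k₂ : ℕ) :
    μ.real {ω | ¬ BilinRIP (M ω) k₁ k₂ (64 * t)} ≤
      n₁.choose (min k₁ n₁) * (n₂.choose (min k₂ n₂) *
        (8 * 25 ^ (2 * (k₁ + k₂)) * Real.exp (-(m * t ^ 2 / 8)))) := by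
  classical
  set bad : Finset (Fin n₁) → Finset (Fin n₂) → Set Ω := fun I K =>
    {ω | ∃ (x x' : Fin n₁ → ℂ) (y y' : Fin n₂ → ℂ), (∀ i, i ∉ I → x i = 0) ∧
        (∀ i, i ∉ I → x' i = 0) ∧ (∀ i, i ∉ K → y i = 0) ∧ (∀ i, i ∉ K → y' i = 0) ∧
        64 * t * (l2norm x * l2norm y * l2norm x' * l2norm y') < ‖bilinDefect (M ω) x y x' y'‖}
    with hbad
  set P₁ := (Finset.univ : Finset (Fin n₁)).powersetCard (min k₁ n₁) with hP₁
  set P₂ := (Finset.univ : Finset (Fin n₂)).powersetCard (min k₂ n₂) with hP₂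
  have hsup : ∀ {n k : ℕ} (I : Finset (Fin n)), I.card ≤ k →
      ∃ J ∈ (Finset.univ : Finset (Fin n)).powersetCard (min k n), I ⊆ J := by
    intro n k I hI
    have hn : I.card ≤ n := by simpa using Finset.card_le_univ I
    obtain ⟨J, hIJ, hJ⟩ := Finset.exists_superset_card_eq (s := I) (n := min k n) (le_min hI hn)
      (by simp)
    exact ⟨J, Finset.mem_powersetCard.2 ⟨Finset.subset_univ _, hJ⟩, hIJ⟩
  have hsub : {ω | ¬ BilinRIP (M ω) k₁ k₂ (64 * t)} ⊆ ⋃ I ∈ P₁, ⋃ K ∈ P₂, bad I K := by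
    intro ω hω
    simp only [Set.mem_ofPred_eq, BilinRIP] at hω
    push Not at hω
    obtain ⟨I, K, hI, hK, x, x', y, y', hx, hx', hy, hy', hlt⟩ := hω
    obtain ⟨I', hI', hII'⟩ := hsup I hI
    obtain ⟨K', hK', hKK'⟩ := hsup K hK
    refine Set.mem_biUnion hI' (Set.mem_biUnion hK' ⟨x, x', y, y', fun i hi => hx i fun h => hi (hII' h),
      fun i hi => hx' i fun h => hi (hII' h), fun i hi => hy i fun h => hi (hKK' h),
      fun i hi => hy' i fun h => hi (hKK' h), hlt⟩)
  refine (measureReal_mono hsub (measure_ne_top μ _)).trans ?_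
  refine measureReal_biUnion_le_card_mul _ _ (by simp [hP₁]) (by positivity) fun I hI => ?_
  refine measureReal_biUnion_le_card_mul _ _ (by simp [hP₂]) (by positivity) fun K hK => ?_
  refine (h.measure_defect_support hM hm ht ht' I K).trans ?_
  have hI' : I.card ≤ k₁ := (Finset.mem_powersetCard.1 hI).2.trans_le (min_le_left _ _)
  have hK' : K.card ≤ k₂ := (Finset.mem_powersetCard.1 hK).2.trans_le (min_le_left _ _)
  gcongr
  norm_num

end Union

end SparsePF

namespace SparsePF

/-! ### Numbers of measurements -/

section Counting

theorem one_le_log_exp_mul_div {a N : ℝ} (ha : 0 < a) (haN : a ≤ N) :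
    1 ≤ Real.log (Real.exp 1 * N / a) := by
  rw [Real.le_log_iff_exp_le (by have := ha.trans_le haN; positivity), le_div_iff₀ ha]
  exact mul_le_mul_of_nonneg_left haN (Real.exp_pos 1).le

/-- Monotonicity of the entropy `a log (e N / a)` on `(0, N]`, from `log x ≤ x - 1` at `x = b / a`.
-/
theorem mul_log_exp_mul_div_mono {a b N : ℝ} (ha : 0 < a) (hab : a ≤ b) (hbN : b ≤ N) :
    a * Real.log (Real.exp 1 * N / a) ≤ b * Real.log (Real.exp 1 * N / b) := by
  have hb := ha.trans_le hab
  have hN := hb.trans_le hbN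
  have h1 := one_le_log_exp_mul_div hb hbN
  have h2 : Real.log (Real.exp 1 * N / a) = Real.log (Real.exp 1 * N / b) + Real.log (b / a) := by
    rw [← Real.log_mul (by positivity) (by positivity)]
    congr 1; field_simp
  have h3 : a * Real.log (b / a) ≤ b - a := by
    have := Real.log_le_sub_one_of_pos (div_pos hb ha)
    calc _ ≤ a * (b / a - 1) := mul_le_mul_of_nonneg_left this ha.le
      _ = b - a := by field_simp
  rw [h2, mul_add]
  nlinarith

theorem one_le_rowLog {n s : ℕ} (hs : 1 ≤ s) (hsn : s ≤ n) : 1 ≤ rowLog n s :=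
  one_le_log_exp_mul_div (by exact_mod_cast hs) (by exact_mod_cast hsn)

theorem one_le_doublyLog {n₁ n₂ s₁ s₂ : ℕ} (hs₁ : 1 ≤ s₁) (h₁ : s₁ ≤ n₁) (h₂ : s₂ ≤ n₂) :
    1 ≤ doublyLog n₁ n₂ s₁ s₂ :=
  one_le_log_exp_mul_div (by exact_mod_cast lt_max_of_lt_left (Nat.lt_of_lt_of_le one_pos hs₁))
    (by exact_mod_cast max_le_max h₁ h₂)

theorem choose_min_le {n s : ℕ} (hs : 1 ≤ s) (hsn : s ≤ n) :
    (n.choose (min (3 * s) n) : ℝ) ≤ Real.exp (3 * (s * rowLog n s)) := by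
  have hs0 : (0 : ℝ) < s := by exact_mod_cast hs
  have hn0 : (0 : ℝ) < n := by exact_mod_cast Nat.lt_of_lt_of_le hs hsn
  rcases le_total (3 * s) n with h | h
  · rw [min_eq_left h]
    have h1 := Nat.choose_le_pow_div (α := ℝ) (3 * s) n
    have h2 := Real.pow_div_factorial_le_exp ((3 * s : ℕ) : ℝ) (by positivity) (3 * s)
    have h3 : Real.exp (3 * (s * rowLog n s)) = (Real.exp 1 * n / s) ^ (3 * s) := by
      rw [rowLog, ← Real.rpow_natCast, Real.rpow_def_of_pos (by positivity)]
      congr 1; push_cast; ring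
    rw [h3]
    refine h1.trans ?_
    calc (n : ℝ) ^ (3 * s) / ((3 * s).factorial : ℝ)
        = (n / (3 * s : ℕ)) ^ (3 * s) * ((3 * s : ℕ) ^ (3 * s) / ((3 * s).factorial : ℝ)) := by
          have : ((3 * s : ℕ) : ℝ) ≠ 0 := by positivity
          rw [div_pow]; field_simp
      _ ≤ (n / (3 * s : ℕ)) ^ (3 * s) * Real.exp ((3 * s : ℕ) : ℝ) :=
          mul_le_mul_of_nonneg_left h2 (by positivity)
      _ = (Real.exp 1 * n / (3 * s : ℕ)) ^ (3 * s) := by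
          rw [← mul_one ((3 * s : ℕ) : ℝ), Real.exp_nat_mul, mul_one, ← mul_pow]
          congr 1; ring
      _ ≤ _ := by
          gcongr
          omega
  · rw [min_eq_right h, Nat.choose_self, Nat.cast_one, Real.one_le_exp_iff]
    have := one_le_rowLog hs hsn
    positivity

theorem eight_mul_pow_le (k : ℕ) : (8 : ℝ) * 25 ^ k ≤ 2 * Real.exp (2 + 4 * k) := by
  have h27 : (5 / 2 : ℝ) ≤ Real.exp 1 := by linarith [Real.exp_one_gt_d9]
  have h2 : Real.exp 2 = Real.exp 1 ^ 2 := by rw [← Real.exp_nat_mul]; norm_num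
  have h4 : Real.exp 4 = Real.exp 1 ^ 4 := by rw [← Real.exp_nat_mul]; norm_num
  have h25 : (25 : ℝ) ≤ Real.exp 4 := by
    rw [h4]
    calc (25 : ℝ) ≤ (5 / 2) ^ 4 := by norm_num
      _ ≤ _ := pow_le_pow_left₀ (by norm_num) h27 4
  have h8 : (8 : ℝ) ≤ 2 * Real.exp 2 := by rw [h2]; nlinarith
  calc (8 : ℝ) * 25 ^ k ≤ 2 * Real.exp 2 * Real.exp 4 ^ k :=
        mul_le_mul h8 (pow_le_pow_left₀ (by norm_num) h25 k) (by positivity) (by positivity)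
    _ = _ := by rw [← Real.exp_nat_mul, mul_assoc, ← Real.exp_add, mul_comm (k : ℝ)]

theorem union_bound_le {m n₁ n₂ s₁ s₂ : ℕ} (hs₁ : 1 ≤ s₁) (h₁ : s₁ ≤ n₁) (hs₂ : 1 ≤ s₂)
    (h₂ : s₂ ≤ n₂) {t R : ℝ} (ht : 0 < t) (hR : (s₁ : ℝ) + s₂ ≤ R)
    (hR' : s₁ * rowLog n₁ s₁ + s₂ * rowLog n₂ s₂ ≤ 2 * R) (hm : 512 / t ^ 2 * R ≤ m) :
    (n₁.choose (min (3 * s₁) n₁) : ℝ) * (n₂.choose (min (3 * s₂) n₂) *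
        (8 * 25 ^ (2 * (3 * s₁ + 3 * s₂)) * Real.exp (-(m * t ^ 2 / 8)))) ≤
      2 * Real.exp (-(t ^ 2 / 16) * m) := by
  have hs₁' : (1 : ℝ) ≤ s₁ := by exact_mod_cast hs₁
  have hs₂' : (1 : ℝ) ≤ s₂ := by exact_mod_cast hs₂
  have hc₁ := choose_min_le hs₁ h₁
  have hc₂ := choose_min_le hs₂ h₂
  have hpow := eight_mul_pow_le (2 * (3 * s₁ + 3 * s₂))
  have hcast : 2 + 4 * ((2 * (3 * s₁ + 3 * s₂) : ℕ) : ℝ) = 2 + 24 * (s₁ + s₂) := by push_cast; ring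
  rw [hcast] at hpow
  have hA : (0 : ℝ) ≤ 8 * 25 ^ (2 * (3 * s₁ + 3 * s₂)) := by positivity
  generalize (8 : ℝ) * 25 ^ (2 * (3 * s₁ + 3 * s₂)) = A at hpow hA ⊢
  generalize (n₁.choose (min (3 * s₁) n₁) : ℝ) = c₁ at hc₁ ⊢
  have hc₂0 : (0 : ℝ) ≤ (n₂.choose (min (3 * s₂) n₂) : ℝ) := Nat.cast_nonneg _
  generalize (n₂.choose (min (3 * s₂) n₂) : ℝ) = c₂ at hc₂ hc₂0 ⊢
  calc c₁ * (c₂ * (A * Real.exp (-(m * t ^ 2 / 8))))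
      ≤ Real.exp (3 * (s₁ * rowLog n₁ s₁)) * (Real.exp (3 * (s₂ * rowLog n₂ s₂)) *
        (2 * Real.exp (2 + 24 * (s₁ + s₂)) * Real.exp (-(m * t ^ 2 / 8)))) := by
        gcongr
    _ = 2 * Real.exp (3 * (s₁ * rowLog n₁ s₁) + (3 * (s₂ * rowLog n₂ s₂) +
        (2 + 24 * (s₁ + s₂) + -(m * t ^ 2 / 8)))) := by
        simp only [Real.exp_add]; ring
    _ ≤ _ := by
        -- The entropy exponent is at most `6 R + 24 R + 2 ≤ 32 R`, as `R ≥ s₁ + s₂ ≥ 2`. The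
        -- constant `512 = 16 · 32` makes this at most `m t² / 16`, half of the available exponent.
        refine mul_le_mul_of_nonneg_left (Real.exp_le_exp.2 ?_) zero_le_two
        have h3 : 512 * R ≤ m * t ^ 2 := by
          rw [div_mul_eq_mul_div, div_le_iff₀ (by positivity)] at hm
          exact hm
        linarith

/-- Rounding up adds at most `1 ≤ Λ · max 1 (x - 2)`, and `x ≤ 3 max 1 (x - 2)`; the maximum matters
at `s₁ = s₂ = 1`, where the lower bound is 0. -/
theorem ceil_mul_le {C x Λ : ℝ} (hC : 0 < C) (hx : 2 ≤ x) (hx' : x = 2 ∨ 3 ≤ x) (hΛ : 1 ≤ Λ) :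
    (⌈C * (x * Λ)⌉₊ : ℝ) ≤ (3 * C + 1) * Λ * max 1 (x - 2) := by
  have h1 := (Nat.ceil_lt_add_one (show 0 ≤ C * (x * Λ) by positivity)).le
  have h2 : x ≤ 3 * max 1 (x - 2) := by
    rcases hx' with h | h
    · linarith [le_max_left 1 (x - 2)]
    · linarith [le_max_right 1 (x - 2)]
  have h3 := le_max_left 1 (x - 2)
  set y := max 1 (x - 2)
  have h4 : C * Λ * x ≤ C * Λ * (3 * y) := mul_le_mul_of_nonneg_left h2 (by positivity)
  have h5 : 1 ≤ Λ * y := one_le_mul_of_one_le_of_one_le hΛ h3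
  linarith

end Counting

/-! ### Probability of the bilinear isometry property and the specialization to both sparsity models
-/

section Assembly

variable {Ω : Type*} [MeasurableSpace Ω] {μ : Measure Ω} {m n₁ n₂ s₁ s₂ : ℕ}
  {M : Ω → Fin m → Matrix (Fin n₁) (Fin n₂) ℂ}

/-- A law only provides almost everywhere measurable entries, while the independence and moment
arguments are run for measurable ones. -/
theorem IsIIDGaussian.exists_measurable_version (h : IsIIDGaussian μ M) :
    ∃ M' : Ω → Fin m → Matrix (Fin n₁) (Fin n₂) ℂ, IsIIDGaussian μ M' ∧
      (∀ l j k, Measurable fun ω => M' ω l j k) ∧ ∀ᵐ ω ∂μ, M ω = M' ω := by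
  have hae : ∀ l j k, AEMeasurable (fun ω => M ω l j k) μ := fun l j k => (h.law l j k).aemeasurable
  choose f hf hfM using hae
  refine ⟨fun ω l j k => f l j k ω, ⟨?_, fun l j k => (h.law l j k).congr (hfM l j k).symm⟩, hf, ?_⟩
  · exact (iIndepFun_congr fun p : Fin m × Fin n₁ × Fin n₂ => hfM p.1 p.2.1 p.2.2).1 h.indep
  · have : ∀ᵐ ω ∂μ, ∀ l j k, M ω l j k = f l j k ω :=
      ae_all_iff.2 fun l => ae_all_iff.2 fun j => ae_all_iff.2 fun k => hfM l j k
    filter_upwards [this] with ω hω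
    ext l j k
    exact hω l j k

theorem IsIIDGaussian.measure_not_bilinRIP_le [IsProbabilityMeasure μ] (h : IsIIDGaussian μ M)
    (hs₁ : 1 ≤ s₁) (h₁ : s₁ ≤ n₁) (hs₂ : 1 ≤ s₂) (h₂ : s₂ ≤ n₂) {t R : ℝ} (ht : 0 < t) (ht' : t ≤ 1)
    (hR : (s₁ : ℝ) + s₂ ≤ R) (hR' : s₁ * rowLog n₁ s₁ + s₂ * rowLog n₂ s₂ ≤ 2 * R)
    (hm : 512 / t ^ 2 * R ≤ m) :
    μ {ω | ¬ BilinRIP (M ω) (3 * s₁) (3 * s₂) (64 * t)} ≤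
      ENNReal.ofReal (2 * Real.exp (-(t ^ 2 / 16) * m)) := by
  have hR0 : 0 < R := by
    have : (1 : ℝ) ≤ s₁ := by exact_mod_cast hs₁
    have : (0 : ℝ) ≤ s₂ := Nat.cast_nonneg _
    linarith
  have hm0 : 0 < m := by
    have : (0 : ℝ) < 512 / t ^ 2 * R := by positivity
    exact Nat.cast_pos.1 (this.trans_le hm)
  obtain ⟨M', h', hM', hMM'⟩ := h.exists_measurable_version
  refine (measure_mono_ae (t := {ω | ¬ BilinRIP (M' ω) (3 * s₁) (3 * s₂) (64 * t)}) ?_).trans ?_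
  · filter_upwards [hMM'] with ω hω hbad
    have hbad' : ¬ BilinRIP (M ω) (3 * s₁) (3 * s₂) (64 * t) := hbad
    rw [hω] at hbad'
    exact hbad'
  · rw [ENNReal.le_ofReal_iff_toReal_le (measure_ne_top _ _) (by positivity)]
    exact (h'.measure_not_bilinRIP hM' hm0 ht.le ht' (3 * s₁) (3 * s₂)).trans
      (union_bound_le hs₁ h₁ hs₂ h₂ ht hR hR' hm)

theorem DoublySparseRIP.mono {A : Fin m → Matrix (Fin n₁) (Fin n₂) ℂ} {r k₁ k₂ : ℕ} {δ δ' : ℝ}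
    (h : DoublySparseRIP A r k₁ k₂ δ) (hδ : δ ≤ δ') : DoublySparseRIP A r k₁ k₂ δ' := by
  intro Z hZ h₁ h₂
  obtain ⟨h3, h4⟩ := h Z hZ h₁ h₂
  have h5 := mul_le_mul_of_nonneg_right hδ (sq_nonneg (frobNorm Z))
  constructor <;> linarith

theorem DoublySparseRIP.rowSparseRIP {A : Fin m → Matrix (Fin n₁) (Fin n₂) ℂ} {r k₁ k₂ : ℕ} {δ : ℝ}
    (h : DoublySparseRIP A r k₁ k₂ δ) (hk : n₂ ≤ k₂) : RowSparseRIP A r k₁ δ := by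
  intro Z hZ h₁
  refine h Z hZ h₁ (le_trans ?_ hk)
  have := Set.ncard_le_card {k | ∃ j, Z j k ≠ 0}
  simpa [nonzeroCols] using this

theorem IsRowOptimalStart.isOptimalStart {s : ℕ} {B : Matrix (Fin n₁) (Fin n₂) ℂ} {v₀ : Fin n₂ → ℂ}
    (h : IsRowOptimalStart s B v₀) : IsOptimalStart s n₂ B v₀ := by
  have h1 : coordProj (Finset.univ : Finset (Fin n₂)) = 1 := by simp [coordProj]
  obtain ⟨J, hJ, hmax, hv⟩ := h
  refine ⟨J, Finset.univ, hJ, by simp, fun K₁ K₂ hK₁ hK₂ => ?_, ?_⟩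
  · have : K₂ = Finset.univ := (Finset.card_eq_iff_eq_univ _).1 (by simpa using hK₂)
    rw [this, h1, Matrix.mul_one, Matrix.mul_one]
    exact hmax K₁ hK₁
  · rwa [h1, Matrix.mul_one]

/-- The smaller sparsity level may have a logarithm far larger than `Λ`. But the product `s log (e n
/ s)` increases with `s` and `n`, so each product is at most its value at the two maxima. -/
theorem doubly_entropy_le (hs₁ : 1 ≤ s₁) (h₁ : s₁ ≤ n₁) (hs₂ : 1 ≤ s₂) (h₂ : s₂ ≤ n₂) :
    s₁ * rowLog n₁ s₁ + s₂ * rowLog n₂ s₂ ≤ 2 * (((s₁ : ℝ) + s₂) * doublyLog n₁ n₂ s₁ s₂) := by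
  have hs₁' : (0 : ℝ) < s₁ := by exact_mod_cast hs₁
  have hs₂' : (0 : ℝ) < s₂ := by exact_mod_cast hs₂
  have hN : ((max s₁ s₂ : ℕ) : ℝ) ≤ (max n₁ n₂ : ℕ) := by exact_mod_cast max_le_max h₁ h₂
  have hbound : ∀ {n s : ℕ}, 1 ≤ s → s ≤ n → n ≤ max n₁ n₂ → s ≤ max s₁ s₂ →
      s * rowLog n s ≤ (max s₁ s₂ : ℕ) * doublyLog n₁ n₂ s₁ s₂ := by
    intro n s hs hsn hn hs'
    have hs0 : (0 : ℝ) < s := by exact_mod_cast hs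
    have hn0 : (0 : ℝ) < n := by exact_mod_cast Nat.lt_of_lt_of_le hs hsn
    refine le_trans ?_ (mul_log_exp_mul_div_mono hs0 (by exact_mod_cast hs') hN)
    rw [rowLog]
    gcongr
  have hmax : ((max s₁ s₂ : ℕ) : ℝ) ≤ s₁ + s₂ := by
    exact_mod_cast max_le (Nat.le_add_right _ _) (Nat.le_add_left _ _)
  have hΛ := one_le_doublyLog hs₁ h₁ h₂
  have h3 := hbound hs₁ h₁ (le_max_left _ _) (le_max_left _ _)
  have h4 := hbound hs₂ h₂ (le_max_right _ _) (le_max_right _ _)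
  have h5 := mul_le_mul_of_nonneg_right hmax (zero_le_one.trans hΛ)
  linarith

theorem rowLog_self {n : ℕ} (hn : 1 ≤ n) : rowLog n n = 1 := by
  have : (n : ℝ) ≠ 0 := by positivity
  rw [rowLog, mul_div_assoc, div_self this, mul_one, Real.log_exp]

end Assembly

end SparsePF

theorem mainTheorem4 :
    ∃ L H κ : ℝ, 0 < L ∧ 0 < H ∧ 0 < κ ∧
      ∀ δ : ℝ, 0 < δ → δ < 1 →
      ∃ C c C' : ℝ, 0 < C ∧ 0 < c ∧ 0 < C' ∧
        -- the doubly sparse case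
        (∀ n₁ n₂ s₁ s₂ : ℕ, 1 ≤ s₁ → s₁ ≤ n₁ → 1 ≤ s₂ → s₂ ≤ n₂ →
          (∀ m : ℕ, C * (((s₁ : ℝ) + s₂) * SparsePF.doublyLog n₁ n₂ s₁ s₂) ≤ m →
            ∀ (Ω : Type*) [MeasurableSpace Ω] (μ : Measure Ω) [IsProbabilityMeasure μ]
              (M : Ω → Fin m → Matrix (Fin n₁) (Fin n₂) ℂ), SparsePF.IsIIDGaussian μ M →
              μ {ω | ¬ (SparsePF.DoublySparseRIP (M ω) 2 (3 * s₁) (3 * s₂) δ ∧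
                  SparsePF.StablyRecovers (M ω) s₁ s₂ (SparsePF.IsOptimalStart s₁ s₂) L H κ)} ≤
                ENNReal.ofReal (2 * Real.exp (-c * m))) ∧
          (⌈C * (((s₁ : ℝ) + s₂) * SparsePF.doublyLog n₁ n₂ s₁ s₂)⌉₊ : ℝ) ≤
            C' * SparsePF.doublyLog n₁ n₂ s₁ s₂ * max 1 ((s₁ : ℝ) + s₂ - 2)) ∧
        -- the row-sparse case
        (∀ n₁ n₂ s : ℕ, 1 ≤ s → s ≤ n₁ → 1 ≤ n₂ →
          (∀ m : ℕ, C * (((s : ℝ) + n₂) * SparsePF.rowLog n₁ s) ≤ m →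
            ∀ (Ω : Type*) [MeasurableSpace Ω] (μ : Measure Ω) [IsProbabilityMeasure μ]
              (M : Ω → Fin m → Matrix (Fin n₁) (Fin n₂) ℂ), SparsePF.IsIIDGaussian μ M →
              μ {ω | ¬ (SparsePF.RowSparseRIP (M ω) 2 (3 * s) δ ∧
                  SparsePF.StablyRecovers (M ω) s n₂ (SparsePF.IsRowOptimalStart s) L H κ)} ≤
                ENNReal.ofReal (2 * Real.exp (-c * m))) ∧
          (⌈C * (((s : ℝ) + n₂) * SparsePF.rowLog n₁ s)⌉₊ : ℝ) ≤
            C' * SparsePF.rowLog n₁ s * max 1 ((s : ℝ) + n₂ - 2)) := by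
  refine ⟨1, 2, 30, one_pos, two_pos, by norm_num, fun δ hδ hδ' => ?_⟩
  -- One `t` meets both demands: `128 t ≤ δ` for the RIP and `64 t ≤ 1/100` for recovery. The
  -- recovery threshold is absolute, so `L`, `H`, `κ` do not depend on `δ`.
  obtain ⟨t, ht, ht', htδ, ht100⟩ : ∃ t : ℝ, 0 < t ∧ t ≤ 1 ∧ 2 * (64 * t) ≤ δ ∧ 64 * t ≤ 1 / 100 :=
    ⟨δ / 6400, by positivity, by linarith, by linarith, by linarith⟩
  have hC : 0 < 512 / t ^ 2 := by positivity
  refine ⟨512 / t ^ 2, t ^ 2 / 16, 3 * (512 / t ^ 2) + 1, hC, by positivity, by positivity, ?_, ?_⟩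
  · intro n₁ n₂ s₁ s₂ hs₁ h₁ hs₂ h₂
    have hs₁' : (1 : ℝ) ≤ s₁ := by exact_mod_cast hs₁
    have hs₂' : (1 : ℝ) ≤ s₂ := by exact_mod_cast hs₂
    have hΛ := SparsePF.one_le_doublyLog hs₁ h₁ h₂
    refine ⟨fun m hm Ω _ μ _ M hM => ?_, ?_⟩
    · refine le_trans (measure_mono ?_) (hM.measure_not_bilinRIP_le hs₁ h₁ hs₂ h₂ ht ht'
        (le_mul_of_one_le_right (by positivity) hΛ) (SparsePF.doubly_entropy_le hs₁ h₁ hs₂ h₂) hm)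
      intro ω hω hB
      exact hω ⟨(hB.doublySparseRIP (by positivity)).mono htδ,
        hB.stablyRecovers (by positivity) ht100 h₁ h₂⟩
    · refine SparsePF.ceil_mul_le hC (by linarith) ?_ hΛ
      rcases Nat.lt_or_ge (s₁ + s₂) 3 with h | h
      · left; exact_mod_cast (by omega : s₁ + s₂ = 2)
      · right; exact_mod_cast h
  · intro n₁ n₂ s hs h₁ hn₂
    have hs' : (1 : ℝ) ≤ s := by exact_mod_cast hs
    have hn₂' : (1 : ℝ) ≤ n₂ := by exact_mod_cast hn₂
    have hΛ := SparsePF.one_le_rowLog hs h₁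
    refine ⟨fun m hm Ω _ μ _ M hM => ?_, ?_⟩
    -- The row-sparse case is `s₂ = n₂`: column sparsity is vacuous, and the column entropy is only
    -- `n₂`, so the logarithm of `n₁ / s` suffices.
    · refine le_trans (measure_mono ?_) (hM.measure_not_bilinRIP_le hs h₁ hn₂ le_rfl ht ht'
        (le_mul_of_one_le_right (by positivity) hΛ) ?_ hm)
      · intro ω hω hB
        refine hω ⟨((hB.doublySparseRIP (by positivity)).mono htδ).rowSparseRIP (by omega), ?_⟩
        intro lam u v X z b hlam hu hv hu0 hv0 hX hb hz N₁ N₂ hN₁ hN₂ v₀ U V hstart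
        exact hB.stablyRecovers (by positivity) ht100 h₁ le_rfl lam u v X z b hlam hu hv hu0 hv0 hX
          hb hz N₁ N₂ hN₁ hN₂ v₀ U V hstart.isOptimalStart
      · rw [SparsePF.rowLog_self hn₂, mul_one]
        nlinarith
    · refine SparsePF.ceil_mul_le hC (by linarith) ?_ hΛ
      rcases Nat.lt_or_ge (s + n₂) 3 with h | h
      · left; exact_mod_cast (by omega : s + n₂ = 2)
      · right; exact_mod_cast h
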